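/- Let $\kappa\le\lambda$ be infinite cardinals with $\lambda^{<\kappa}=\lambda$, let $P_\kappa(\lambda)=\{x\subseteq\lambda:|x|<\kappa\}$, and let $\theta>\lambda$ be a regular cardinal, where $H_\theta$ denotes the set of all sets hereditarily of size $<\theta$. For $Y,X\subseteq P_\kappa(\lambda)$ write $Y\subseteq_{\mathcal F}X$ if $Y\cap A\subseteq X$ for some $A$ in the fine filter, i.e. the filter generated by the sets $\{x\in P_\kappa(\lambda):a\in x\}$, $a<\lambda$. A $(\kappa,\lambda)$-model is a set $N\prec H_\theta$ of size $\lambda$ with $\lambda+1\subseteq N$ and $P_\kappa(\lambda)\subseteq N$. Fix an internally approachable sequence $\langle N_i:i<\lambda^+\rangle$ of $(\kappa,\lambda)$-models, i.e. an increasing continuous elementary chain such that $\langle N_i:i<\alpha\rangle\in N_{\alpha'}$ for all $\alpha<\alpha'<\lambda^+$. Suppose that $\lambda^+<\theta$, or that $H_\theta=\bigcup_{i<\lambda^+}N_i$. A normal $N$-ultrafilter is a family $U\subseteq P(P_\kappa(\lambda))\cap N$ which is a proper filter on $P(P_\kappa(\lambda))\cap N$, measures every set in $P(P_\kappa(\lambda))\cap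 N$, contains $\{x\in P_\kappa(\lambda):a\in x\}$ for all $a<\lambda$, and contains the diagonal intersection $\triangle_{a<\lambda}X_a=\{x\in P_\kappa(\lambda):\forall a\in x\;(x\in X_a)\}$ whenever $\langle X_a:a<\lambda\rangle\in N$ and all $X_a\in U$. Let $\gamma\le\lambda^+$ be an ordinal. In round $i$ of the game $G_1^\gamma$ the Challenger first plays an ordinal $\alpha_i<\lambda^+$ larger than all $\alpha_j$, $j<i$, and such that $\langle U_j:j<i\rangle\in N_{\alpha_i+1}$; the Judge answers with a normal $N_{\alpha_i+1}$-ultrafilter $U_i$ such that $U_j\subseteq U_i$ for all $j<i$. In round $i$ of the game $G_2^\gamma$ the Challenger first plays an ordinal $\alpha_i<\lambda^+$ larger than all $\alpha_j$, $j<i$, and such that $\langle Y_j:j<i\rangle\in N_{\alpha_i+1}$; the Judge answers with a set $Y_i\subseteq P_\kappa(\lambda)$ such that $Y_i\subseteq_{\mathcal F}Y_j$ for all $j<i$ and $\{X\in P(P_\kappa(\lambda))\cap N_{\alpha_i+1}:Y_i\subseteq_{\mathcal F}X\}$ is a normal $N_{\alpha_i+1}$-ultrafilter. In both games a play ends when a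 player has no legal move or when it has reached length $\gamma$, and the Judge wins if and only if the play reaches length $\gamma$. Then: (a) if the Judge has a winning strategy in $G_2^\gamma$, then the Judge has a winning strategy in $G_1^\gamma$; (b) if $\gamma$ is not a successor ordinal, or if $2^{<\lambda}=\lambda$, then conversely, if the Judge has a winning strategy in $G_1^\gamma$, then the Judge has a winning strategy in $G_2^\gamma$. In particular, if $\gamma$ is not a successor ordinal or $2^{<\lambda}=\lambda$, the Judge has a winning strategy in $G_1^\gamma$ if and only if the Judge has a winning strategy in $G_2^\gamma$. -/

import Mathlib

open Cardinal Ordinal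

universe u

noncomputable section

namespace FilterGame

/-! ### Elementary submodels of `H_θ` -/

/-- The only symbol of the language of set theory. -/
inductive MemRel : ℕ → Type
  | mem : MemRel 2

/-- The first-order language of set theory, with one binary relation symbol. -/
def setLang : FirstOrder.Language := ⟨fun _ => Empty, MemRel⟩

/-- Every collection of sets is a structure `(A, ∈)`. -/
instance memStructure (A : Set ZFSet.{u}) : setLang.Structure A where
  funMap := fun f => Empty.elim f
  RelMap := fun r => match r with
    | MemRel.mem => fun x => (x 0 : ZFSet.{u}) ∈ (x 1 : ZFSet.{u})

/-- `A ≺ B`: `(A, ∈)` is an elementary substructure of `(B, ∈)`. -/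
def IsElemSub (A B : Set ZFSet.{u}) : Prop :=
  ∃ h : A ⊆ B, ∀ (n : ℕ) (φ : setLang.Formula (Fin n)) (v : Fin n → A),
    φ.Realize (fun i => Set.inclusion h (v i)) ↔ φ.Realize v

/-- `H_θ`, the sets that are hereditarily of cardinality less than `θ`. -/
def H (θ : Cardinal.{u}) : Set ZFSet.{u} :=
  {x | ZFSet.Hereditarily (fun y => y.card < θ) x}

/-! ### The set `P_κ(λ)` -/

/-- `P_κ(λ)`, the set of all subsets of (the von Neumann ordinal) `λ` of size less than `κ`. -/
def Pk (κ lam : Cardinal.{u}) : ZFSet.{u} :=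
  ZFSet.sep (fun x => x.card < κ) (ZFSet.powerset lam.ord.toZFSet)

/-- The cone `{x ∈ P_κ(λ) : a ∈ x}`. -/
def cone (κ lam : Cardinal.{u}) (a : Ordinal.{u}) : ZFSet.{u} :=
  ZFSet.sep (fun x => a.toZFSet ∈ x) (Pk κ lam)

/-- The fine filter, generated by the cones `{x ∈ P_κ(λ) : a ∈ x}`, `a < λ`. -/
def fineFilter (κ lam : Cardinal.{u}) : Filter ZFSet.{u} :=
  Filter.generate {S | ∃ a < lam.ord, S = {x | x ∈ cone κ lam a}}

/-- `Y ⊆_F X`: inclusion modulo the fine filter. -/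
def SubsetMod (κ lam : Cardinal.{u}) (Y X : ZFSet.{u}) : Prop :=
  ∃ A ∈ fineFilter κ lam, ∀ x ∈ Y, x ∈ A → x ∈ X

/-- The diagonal intersection `{x ∈ P_κ(λ) : ∀ a ∈ x, x ∈ X a}` of `⟨X a : a < λ⟩`. -/
def diagInter (κ lam : Cardinal.{u}) (X : Ordinal.{u} → ZFSet.{u}) : ZFSet.{u} :=
  ZFSet.sep (fun x => ∀ a < lam.ord, a.toZFSet ∈ x → x ∈ X a) (Pk κ lam)

/-- The sequence `⟨f j : j < i⟩` as a set, namely the function `{(j, f j) : j < i}`. -/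
def seq (i : Ordinal.{u}) (f : Ordinal.{u} → ZFSet.{u}) : ZFSet.{u} :=
  ZFSet.range (fun j : Set.Iio i => ZFSet.pair (j : Ordinal.{u}).toZFSet (f j))

/-! ### Models and their ultrafilters -/

/-- `(κ, λ)`-models: elementary submodels of `H_θ` of size `λ` that contain `λ + 1` and `P_κ(λ)`
as subsets. Transitivity is not demanded: it is automatic if `θ = λ⁺`, and it cannot hold if
`θ > λ⁺`, since then `λ⁺ ∈ N`. The axioms of `ZFC⁻` and `Σ₀`-elementarity in the universe are
consequences of elementarity in `H_θ` for `θ` regular and uncountable. -/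
structure IsModel (κ lam θ : Cardinal.{u}) (N : ZFSet.{u}) : Prop where
  elem : IsElemSub (N : Set ZFSet.{u}) (H θ)
  card_eq : N.card = lam
  ordinal_subset : (Order.succ lam.ord).toZFSet ⊆ N
  Pk_subset : Pk κ lam ⊆ N

/-- An internally approachable sequence `⟨N i : i < λ⁺⟩` of `(κ, λ)`-models
(only the values `N i` with `i < λ⁺` matter). -/
structure IsInternallyApproachable (κ lam θ : Cardinal.{u}) (N : Ordinal.{u} → ZFSet.{u}) :
    Prop where
  model : ∀ i < (Order.succ lam).ord, IsModel κ lam θ (N i)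
  chain : ∀ i j, i < j → j < (Order.succ lam).ord →
    IsElemSub (N i : Set ZFSet.{u}) (N j : Set ZFSet.{u})
  continuous : ∀ δ < (Order.succ lam).ord, Order.IsSuccLimit δ →
    ∀ x, x ∈ N δ ↔ ∃ i < δ, x ∈ N i
  approach : ∀ a b, a < b → b < (Order.succ lam).ord → seq a N ∈ N b

/-- `U` is a (fine) normal `N`-ultrafilter on `P_κ(λ)`. -/
structure IsNormalUltrafilter (κ lam : Cardinal.{u}) (N U : ZFSet.{u}) : Prop where
  subset : ∀ X ∈ U, X ∈ N ∧ X ⊆ Pk κ lam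
  univ_mem : Pk κ lam ∈ U
  empty_notMem : ∅ ∉ U
  inter_mem : ∀ X ∈ U, ∀ Y ∈ U, X ∩ Y ∈ U
  mem_of_superset : ∀ X ∈ U, ∀ Y ∈ N, X ⊆ Y → Y ⊆ Pk κ lam → Y ∈ U
  measures : ∀ X ∈ N, X ⊆ Pk κ lam → X ∈ U ∨ Pk κ lam \ X ∈ U
  fine : ∀ a < lam.ord, cone κ lam a ∈ U
  normal : ∀ X : Ordinal.{u} → ZFSet.{u}, seq lam.ord X ∈ N → (∀ a < lam.ord, X a ∈ U) →
    diagInter κ lam X ∈ U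

/-- `{X ∈ P(P_κ(λ)) ∩ N : Y ⊆_F X}`. -/
def generated (κ lam : Cardinal.{u}) (N Y : ZFSet.{u}) : ZFSet.{u} :=
  ZFSet.sep (fun X => X ⊆ Pk κ lam ∧ SubsetMod κ lam Y X) N

/-! ### The games

In round `i` the Challenger first plays an ordinal `α i`, then the Judge answers with a set `m i`.
A play is given by the two functions `α` and `m`, of which only the values at the rounds played so
far matter. -/

/-- The ordinal `a` is a legal move of the Challenger in round `i`, after the moves `α j`, `m j`,
`j < i`: the Challenger's ordinals are increasing and less than `λ⁺`, and the sequence of the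
Judge's previous moves lies in `N (a + 1)`. -/
def ChallengerLegal (lam : Cardinal.{u}) (N : Ordinal.{u} → ZFSet.{u})
    (α : Ordinal.{u} → Ordinal.{u}) (m : Ordinal.{u} → ZFSet.{u}) (i a : Ordinal.{u}) : Prop :=
  a < (Order.succ lam).ord ∧ (∀ j < i, α j < a) ∧ seq i m ∈ N (a + 1)

/-- The rule for the Judge's move `m i` in the game `G₁`: it is a normal
`N (α i + 1)`-ultrafilter that extends the previous ones. -/
def JudgeLegal₁ (κ lam : Cardinal.{u}) (N : Ordinal.{u} → ZFSet.{u})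
    (α : Ordinal.{u} → Ordinal.{u}) (m : Ordinal.{u} → ZFSet.{u}) (i : Ordinal.{u}) : Prop :=
  IsNormalUltrafilter κ lam (N (α i + 1)) (m i) ∧ ∀ j < i, m j ⊆ m i

/-- The rule for the Judge's move `m i` in the game `G₂`: it is a subset of `P_κ(λ)`, contained
modulo the fine filter in the previous ones, that generates a normal `N (α i + 1)`-ultrafilter. -/
def JudgeLegal₂ (κ lam : Cardinal.{u}) (N : Ordinal.{u} → ZFSet.{u})
    (α : Ordinal.{u} → Ordinal.{u}) (m : Ordinal.{u} → ZFSet.{u}) (i : Ordinal.{u}) : Prop :=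
  m i ⊆ Pk κ lam ∧ (∀ j < i, SubsetMod κ lam (m i) (m j)) ∧
    IsNormalUltrafilter κ lam (N (α i + 1)) (generated κ lam (N (α i + 1)) (m i))

/-- A strategy for the Judge: the move in round `i` as a function of the Challenger's moves in the
rounds `j ≤ i` and of the Judge's moves in the rounds `j < i`. -/
abbrev Strategy : Type (u + 1) :=
  (i : Ordinal.{u}) → (Set.Iic i → Ordinal.{u}) → (Set.Iio i → ZFSet.{u}) → ZFSet.{u}

/-- The first `ℓ` rounds `(α j, m j)`, `j < ℓ`, are a run in which the Challenger moves legally and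
the Judge follows the strategy `σ`. -/
def IsRun (lam : Cardinal.{u}) (N : Ordinal.{u} → ZFSet.{u}) (σ : Strategy.{u})
    (α : Ordinal.{u} → Ordinal.{u}) (m : Ordinal.{u} → ZFSet.{u}) (ℓ : Ordinal.{u}) : Prop :=
  ∀ i < ℓ, ChallengerLegal lam N α m i (α i) ∧ m i = σ i (fun j => α j) (fun j => m j)

/-- `σ` wins the game of length `γ` in which the Judge has to obey the rule `J`. The Judge wins a
play only if it reaches length `γ`; so in every run according to `σ` the Judge's moves obey the
rule, and a run of length less than `γ` can be continued by a legal move of the Challenger. -/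
def IsWinning (lam : Cardinal.{u}) (N : Ordinal.{u} → ZFSet.{u}) (γ : Ordinal.{u})
    (J : (Ordinal.{u} → Ordinal.{u}) → (Ordinal.{u} → ZFSet.{u}) → Ordinal.{u} → Prop)
    (σ : Strategy.{u}) : Prop :=
  ∀ α m ℓ, ℓ ≤ γ → IsRun lam N σ α m ℓ →
    (∀ i < ℓ, J α m i) ∧ (ℓ < γ → ∃ a, ChallengerLegal lam N α m ℓ a)

/-- The Judge has a winning strategy in the ultrafilter game `G₁` of length `γ`. -/
def JudgeWins₁ (κ lam : Cardinal.{u}) (N : Ordinal.{u} → ZFSet.{u}) (γ : Ordinal.{u}) : Prop :=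
  ∃ σ, IsWinning lam N γ (JudgeLegal₁ κ lam N) σ

/-- The Judge has a winning strategy in the set game `G₂` of length `γ`. -/
def JudgeWins₂ (κ lam : Cardinal.{u}) (N : Ordinal.{u} → ZFSet.{u}) (γ : Ordinal.{u}) : Prop :=
  ∃ σ, IsWinning lam N γ (JudgeLegal₂ κ lam N) σ

end FilterGame

end

noncomputable section

namespace FilterGame

/-! In both directions the Judge keeps a simulated run of the other game, with the Challenger's
ordinals raised where necessary, and translates the answers. A set `Y` that generates a normal
ultrafilter on a large model yields the ultrafilter it generates on a smaller one, and `⊆_F` between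
sets gives inclusion of these ultrafilters. Conversely, an ultrafilter `U` answered before the last
round lies in a later model, because the Challenger still has a legal move. That model enumerates
`U` in length `λ`. The diagonal intersection of the enumeration is a pseudo-intersection of `U`, and
by normality it belongs to all ultrafilters extending `U` on large enough models
(`exists_generator`). In a last round no later model is available. There `exists_pseudoIntersection`
diagonalizes through the initial segments of `U` under an enumeration of a smaller model, and
`2^{<λ} = λ` puts these segments into the larger model.

The delicate point is that the Judge wins only if the Challenger never gets stuck, so the sequence
of translated moves has to lie in some `N b`. This is immediate if the models exhaust `H θ`. If `λ⁺
< θ`, the sequence is one of at most `λ^|ℓ|` functions from `ℓ` into a single model, and all of them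
are in the union of the models once `λ^|ℓ| ≤ λ⁺` (`IsInternallyApproachable.seq_inUnion_of_power`).

That inequality is extracted from the winning strategy (`IsWinning.power_le`). A set in the union is
a legal answer to boundedly many moves only (`boundedFibers₁`, `boundedFibers₂`), so every position
followed by a further round has `λ⁺` moves with distinct answers. The resulting tree has `(λ⁺)^|ℓ|`
distinct sequences of answers, and all of them lie in the union of the models, which has size at
most `λ⁺`. -/

/-! ### Definability over `H θ`, with the formulas assembled by instance search -/

theorem H_trans {θ : Cardinal.{u}} {x y : ZFSet.{u}} (hx : x ∈ H θ) (hy : y ∈ x) : y ∈ H θ :=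
  ZFSet.Hereditarily.mem hx hy

theorem mem_H {θ : Cardinal.{u}} {x : ZFSet.{u}} (hc : x.card < θ) (h : ∀ y ∈ x, y ∈ H θ) :
    x ∈ H θ :=
  ZFSet.hereditarily_iff.2 ⟨hc, h⟩

/-- The membership symbol. -/
def memSymbol : setLang.Relations 2 := MemRel.mem

/-- `P` is definable over `H θ`, without parameters. -/
class Dfn (θ : Cardinal.{u}) {n : ℕ} (P : (Fin n → ZFSet.{u}) → Prop) : Prop where
  out : ∃ φ : setLang.Formula (Fin n), ∀ v : Fin n → (H θ),
    φ.Realize v ↔ P (fun i => v i)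

section
variable {θ : Cardinal.{u}} {n : ℕ} {P Q : (Fin n → ZFSet.{u}) → Prop}
  {i j : Fin n}

instance Dfn.mem : Dfn θ (fun v => v i ∈ v j) :=
  ⟨memSymbol.formula₂ (FirstOrder.Language.Term.var i) (FirstOrder.Language.Term.var j),
    fun v => by rw [FirstOrder.Language.Formula.realize_rel₂]; rfl⟩

instance Dfn.eq : Dfn θ (fun v => v i = v j) :=
  ⟨FirstOrder.Language.Term.equal (FirstOrder.Language.Term.var i)
    (FirstOrder.Language.Term.var j), fun v => by
      simp [FirstOrder.Language.Formula.realize_equal, Subtype.ext_iff]⟩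

instance Dfn.not [hP : Dfn θ P] : Dfn θ (fun v => ¬ P v) := by
  obtain ⟨φ, hφ⟩ := hP
  exact ⟨φ.not, fun v => by rw [FirstOrder.Language.Formula.realize_not, hφ]⟩

instance Dfn.imp [hP : Dfn θ P] [hQ : Dfn θ Q] : Dfn θ (fun v => P v → Q v) := by
  obtain ⟨φ, hφ⟩ := hP
  obtain ⟨ψ, hψ⟩ := hQ
  exact ⟨φ.imp ψ, fun v => by rw [FirstOrder.Language.Formula.realize_imp, hφ, hψ]⟩

theorem Dfn.congr {P Q : (Fin n → ZFSet.{u}) → Prop} (hP : Dfn θ P)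
    (h : ∀ v, (∀ i, v i ∈ H θ) → (P v ↔ Q v)) : Dfn θ Q := by
  obtain ⟨φ, hφ⟩ := hP
  exact ⟨φ, fun v => (hφ v).trans (h _ fun i => (v i).2)⟩

instance Dfn.and [hP : Dfn θ P] [hQ : Dfn θ Q] : Dfn θ (fun v => P v ∧ Q v) :=
  Dfn.congr (P := fun v => ¬ (P v → ¬ Q v)) inferInstance fun v _ => by tauto

instance Dfn.or [hP : Dfn θ P] [hQ : Dfn θ Q] : Dfn θ (fun v => P v ∨ Q v) :=
  Dfn.congr (P := fun v => (¬ P v) → Q v) inferInstance fun v _ => by tauto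

instance Dfn.iff [hP : Dfn θ P] [hQ : Dfn θ Q] : Dfn θ (fun v => P v ↔ Q v) :=
  Dfn.congr (P := fun v => (P v → Q v) ∧ (Q v → P v)) inferInstance fun v _ => by tauto

end

open FirstOrder Language in
instance Dfn.all {θ : Cardinal.{u}} {n : ℕ} {R : (Fin n → ZFSet.{u}) → ZFSet.{u} → Prop}
    [h : Dfn θ (fun v : Fin (n + 1) → ZFSet.{u} => R (fun i => v i.castSucc) (v (Fin.last n)))] :
    Dfn θ (fun v => ∀ x ∈ H θ, R v x) := by
  obtain ⟨φ, hφ⟩ := h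
  -- The last free variable becomes the bound one; the others stay free.
  let g : Fin (n + 1) → Fin n ⊕ Fin 1 :=
    fun i => Fin.lastCases (motive := fun _ => Fin n ⊕ Fin 1) (Sum.inr 0) (fun i => Sum.inl i) i
  have key : ∀ (v : Fin n → H θ) (x : H θ),
      (BoundedFormula.relabel (n := 1) (k := 0) g φ).Realize v (Fin.snoc default x) ↔
        R (fun i => v i) x := by
    intro v x
    have h2 : (fun i => ((Fin.snoc (α := fun _ => H θ) v x : Fin (n + 1) → H θ) i.castSucc : ZFSet))
        = fun i => (v i : ZFSet) := by
      funext i; simp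
    have h1 := hφ (Fin.snoc (α := fun _ => H θ) v x)
    rw [h2] at h1
    simp only [Fin.snoc_last] at h1
    rw [← h1, BoundedFormula.realize_relabel, Formula.Realize]
    refine iff_of_eq (congrArg₂ _ ?_ (Subsingleton.elim _ _))
    funext i
    refine Fin.lastCases ?_ (fun i => ?_) i
    · simp [g, Fin.snoc]
    · simp [g]
  refine ⟨(BoundedFormula.relabel (n := 1) (k := 0) g φ).all, fun v => ?_⟩
  rw [Formula.Realize, BoundedFormula.realize_all]
  exact ⟨fun h x hx => (key v ⟨x, hx⟩).1 (h _), fun h x => (key v x).2 (h x x.2)⟩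

section
variable {θ : Cardinal.{u}} {n : ℕ} {i j k : Fin n}
  {R : (Fin n → ZFSet.{u}) → ZFSet.{u} → Prop}

instance Dfn.ex
    [h : Dfn θ (fun v : Fin (n + 1) → ZFSet.{u} => R (fun i => v i.castSucc) (v (Fin.last n)))] :
    Dfn θ (fun v => ∃ x ∈ H θ, R v x) :=
  Dfn.congr (P := fun v => ¬ ∀ x ∈ H θ, ¬ R v x) inferInstance fun v _ => by simp

/-- Transitivity of `H θ` makes a quantifier over a member of `H θ` a quantifier over the structure.
-/
instance Dfn.ball [h : Dfn θ (fun v : Fin (n + 1) → ZFSet.{u} => R (fun i => v i.castSucc) (v (Fin.last n)))] :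
    Dfn θ (fun v => ∀ x ∈ v j, R v x) :=
  Dfn.congr (P := fun v => ∀ x ∈ H θ, x ∈ v j → R v x) inferInstance fun _ hv =>
    ⟨fun h x hx => h x (H_trans (hv _) hx) hx, fun h x _ hx => h x hx⟩

instance Dfn.bex [h : Dfn θ (fun v : Fin (n + 1) → ZFSet.{u} => R (fun i => v i.castSucc) (v (Fin.last n)))] :
    Dfn θ (fun v => ∃ x ∈ v j, R v x) :=
  Dfn.congr (P := fun v => ¬ ∀ x ∈ v j, ¬ R v x) inferInstance fun v _ => by simp

instance Dfn.subset : Dfn θ (fun v => v i ⊆ v j) :=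
  Dfn.congr (P := fun v => ∀ x ∈ v i, x ∈ v j) inferInstance fun _ _ => Iff.rfl

/-- Only bounded quantifiers occur on the right, so the `Dfn` instances apply to it. -/
theorem mem_pair_iff {x y z : ZFSet.{u}} : z = ZFSet.pair x y ↔
    (∃ a ∈ z, (∀ b ∈ a, b = x) ∧ x ∈ a) ∧ (∃ a ∈ z, (∀ b ∈ a, b = x ∨ b = y) ∧ x ∈ a ∧ y ∈ a) ∧
      ∀ a ∈ z, ((∀ b ∈ a, b = x) ∧ x ∈ a) ∨ ((∀ b ∈ a, b = x ∨ b = y) ∧ x ∈ a ∧ y ∈ a) := by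
  have h1 : ∀ a : ZFSet.{u}, ((∀ b ∈ a, b = x) ∧ x ∈ a) ↔ a = {x} := fun a =>
    ⟨fun h => ZFSet.ext fun b => by
      rw [ZFSet.mem_singleton]; exact ⟨h.1 b, fun e => e ▸ h.2⟩, by rintro rfl; simp⟩
  have h2 : ∀ a : ZFSet.{u}, ((∀ b ∈ a, b = x ∨ b = y) ∧ x ∈ a ∧ y ∈ a) ↔ a = {x, y} := fun a =>
    ⟨fun h => ZFSet.ext fun b => by
      rw [ZFSet.mem_pair]
      exact ⟨h.1 b, fun e => e.elim (fun e => e ▸ h.2.1) (fun e => e ▸ h.2.2)⟩,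
      by rintro rfl; simp⟩
  simp only [h1, h2]
  constructor
  · rintro rfl
    simp [ZFSet.pair]
  · rintro ⟨⟨a, ha, rfl⟩, ⟨b, hb, rfl⟩, h⟩
    ext c
    rw [ZFSet.pair, ZFSet.mem_pair]
    exact ⟨h c, fun e => e.elim (fun e => e ▸ ha) (fun e => e ▸ hb)⟩

instance Dfn.eq_pair :
    Dfn θ (fun v => v k = ZFSet.pair (v i) (v j)) :=
  Dfn.congr (P := fun v => (∃ a ∈ v k, (∀ b ∈ a, b = v i) ∧ v i ∈ a) ∧
    (∃ a ∈ v k, (∀ b ∈ a, b = v i ∨ b = v j) ∧ v i ∈ a ∧ v j ∈ a) ∧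
      ∀ a ∈ v k, ((∀ b ∈ a, b = v i) ∧ v i ∈ a) ∨
        ((∀ b ∈ a, b = v i ∨ b = v j) ∧ v i ∈ a ∧ v j ∈ a)) inferInstance
    fun _ _ => mem_pair_iff.symm

instance Dfn.pair_mem :
    Dfn θ (fun v => ZFSet.pair (v i) (v j) ∈ v k) :=
  Dfn.congr (P := fun v => ∃ p ∈ v k, p = ZFSet.pair (v i) (v j)) inferInstance
    fun _ _ => by simp

end

/-! ### Reflection to elementary submodels -/

/-- An element definable over `H θ` from parameters in `N` can be found in `N`. -/
theorem IsElemSub.reflect {θ : Cardinal.{u}} {N : ZFSet.{u}}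
    (hN : IsElemSub (N : Set ZFSet.{u}) (H θ))
    {n : ℕ} (R : (Fin n → ZFSet.{u}) → ZFSet.{u} → Prop)
    [h : Dfn θ (fun v : Fin (n + 1) → ZFSet.{u} => R (fun i => v i.castSucc) (v (Fin.last n)))]
    (v : Fin n → ZFSet.{u}) (hv : ∀ i, v i ∈ N) (hex : ∃ x ∈ H θ, R v x) : ∃ x ∈ N, R v x := by
  obtain ⟨hsub, hel⟩ := hN
  obtain ⟨φ, hφ⟩ := h
  have key : ∀ x : (N : Set ZFSet.{u}), φ.Realize (Fin.snoc (α := fun _ => (N : Set ZFSet.{u}))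
      (fun i => (⟨v i, hv i⟩ : (N : Set ZFSet.{u}))) x) ↔ R v x := by
    intro x
    rw [← hel, hφ]
    simp
  let g : Fin (n + 1) → Fin n ⊕ Fin 1 :=
    fun i => Fin.lastCases (motive := fun _ => Fin n ⊕ Fin 1) (Sum.inr 0) (fun i => Sum.inl i) i
  have real : ∀ (A : Set ZFSet.{u}) (w : Fin n → A),
      (FirstOrder.Language.BoundedFormula.relabel (n := 1) (k := 0) g φ).ex.Realize w default ↔
        ∃ x : A, φ.Realize (Fin.snoc (α := fun _ => A) w x) := by
    intro A w
    rw [FirstOrder.Language.BoundedFormula.realize_ex]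
    refine exists_congr fun x => ?_
    rw [FirstOrder.Language.BoundedFormula.realize_relabel, FirstOrder.Language.Formula.Realize]
    refine iff_of_eq (congrArg₂ _ ?_ (Subsingleton.elim _ _))
    funext i
    refine Fin.lastCases ?_ (fun i => ?_) i
    · simp [g, Fin.snoc]
    · simp [g]
  have := (hel n (FirstOrder.Language.BoundedFormula.relabel (n := 1) (k := 0) g φ).ex
    (fun i => ⟨v i, hv i⟩)).1 ((real _ _).2 (by
      obtain ⟨x, hx, hR⟩ := hex
      refine ⟨⟨x, hx⟩, (hφ _).2 ?_⟩
      simpa using hR))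
  obtain ⟨x, hx⟩ := (real _ _).1 this
  exact ⟨x, x.2, (key x).1 hx⟩

/-- A set definable over `H θ` from parameters in `N` is in `N`. -/
theorem IsElemSub.mem_of_ext {θ : Cardinal.{u}} {N : ZFSet.{u}}
    (hN : IsElemSub (N : Set ZFSet.{u}) (H θ))
    {n : ℕ} (v : Fin n → ZFSet.{u}) (hv : ∀ i, v i ∈ N)
    (R : (Fin n → ZFSet.{u}) → ZFSet.{u} → Prop)
    [h : Dfn θ (fun v : Fin (n + 1) → ZFSet.{u} => R (fun i => v i.castSucc) (v (Fin.last n)))]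
    {C : ZFSet.{u}} (hC : C ∈ H θ) (hext : ∀ y ∈ H θ, y ∈ C ↔ R v y) : C ∈ N := by
  have h' : Dfn θ (fun v : Fin (n + 1 + 1) → ZFSet.{u} => R (fun i => v i.castSucc.castSucc)
      (v (Fin.last _))) := by
    obtain ⟨φ, hφ⟩ := h
    refine ⟨φ.relabel (fun i => Fin.lastCases (motive := fun _ => Fin (n + 1 + 1)) (Fin.last _)
      (fun i => i.castSucc.castSucc) i), fun v => ?_⟩
    rw [FirstOrder.Language.Formula.realize_relabel, hφ]
    simp
  obtain ⟨D, hD, hDC⟩ := hN.reflect (fun v x => ∀ y ∈ H θ, y ∈ x ↔ R v y) v hv ⟨C, hC, hext⟩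
  suffices C = D by rwa [this]
  have hDH : D ∈ H θ := hN.1 hD
  ext y
  exact ⟨fun hy => (hDC y (H_trans hC hy)).2 ((hext y (H_trans hC hy)).1 hy),
    fun hy => (hext y (H_trans hDH hy)).2 ((hDC y (H_trans hDH hy)).1 hy)⟩


section
variable {θ : Cardinal.{u}} {N a b c d e : ZFSet.{u}}

theorem IsElemSub.reflect₂ (hN : IsElemSub (N : Set ZFSet.{u}) (H θ))
    (R : ZFSet.{u} → ZFSet.{u} → ZFSet.{u} → Prop)
    [hR : Dfn θ (fun v : Fin 3 → ZFSet.{u} => R (v 0) (v 1) (v 2))]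
    (ha : a ∈ N) (hb : b ∈ N) (hex : ∃ x ∈ H θ, R a b x) : ∃ x ∈ N, R a b x :=
  hN.reflect (h := hR) (n := 2) (fun v x => R (v 0) (v 1) x) ![a, b] (by simp [Fin.forall_fin_succ, *]) hex

theorem IsElemSub.reflect₃ (hN : IsElemSub (N : Set ZFSet.{u}) (H θ))
    (R : ZFSet.{u} → ZFSet.{u} → ZFSet.{u} → ZFSet.{u} → Prop)
    [hR : Dfn θ (fun v : Fin 4 → ZFSet.{u} => R (v 0) (v 1) (v 2) (v 3))]
    (ha : a ∈ N) (hb : b ∈ N) (hc : c ∈ N) (hex : ∃ x ∈ H θ, R a b c x) : ∃ x ∈ N, R a b c x :=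
  hN.reflect (h := hR) (n := 3) (fun v x => R (v 0) (v 1) (v 2) x) ![a, b, c]
    (by simp [Fin.forall_fin_succ, *]) hex

theorem IsElemSub.mem_of_ext₂ (hN : IsElemSub (N : Set ZFSet.{u}) (H θ))
    (R : ZFSet.{u} → ZFSet.{u} → ZFSet.{u} → Prop)
    [hR : Dfn θ (fun v : Fin 3 → ZFSet.{u} => R (v 0) (v 1) (v 2))]
    (ha : a ∈ N) (hb : b ∈ N) {C : ZFSet.{u}} (hC : C ∈ H θ)
    (hext : ∀ y ∈ H θ, y ∈ C ↔ R a b y) : C ∈ N :=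
  hN.mem_of_ext (h := hR) (n := 2) ![a, b] (by simp [Fin.forall_fin_succ, *])
    (fun v x => R (v 0) (v 1) x) hC hext

theorem IsElemSub.mem_of_ext₃ (hN : IsElemSub (N : Set ZFSet.{u}) (H θ))
    (R : ZFSet.{u} → ZFSet.{u} → ZFSet.{u} → ZFSet.{u} → Prop)
    [hR : Dfn θ (fun v : Fin 4 → ZFSet.{u} => R (v 0) (v 1) (v 2) (v 3))]
    (ha : a ∈ N) (hb : b ∈ N) (hc : c ∈ N) {C : ZFSet.{u}} (hC : C ∈ H θ)
    (hext : ∀ y ∈ H θ, y ∈ C ↔ R a b c y) : C ∈ N :=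
  hN.mem_of_ext (h := hR) (n := 3) ![a, b, c] (by simp [Fin.forall_fin_succ, *])
    (fun v x => R (v 0) (v 1) (v 2) x) hC hext

theorem IsElemSub.mem_of_ext₄ (hN : IsElemSub (N : Set ZFSet.{u}) (H θ))
    (R : ZFSet.{u} → ZFSet.{u} → ZFSet.{u} → ZFSet.{u} → ZFSet.{u} → Prop)
    [hR : Dfn θ (fun v : Fin 5 → ZFSet.{u} => R (v 0) (v 1) (v 2) (v 3) (v 4))]
    (ha : a ∈ N) (hb : b ∈ N) (hc : c ∈ N) (hd : d ∈ N) {C : ZFSet.{u}} (hC : C ∈ H θ)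
    (hext : ∀ y ∈ H θ, y ∈ C ↔ R a b c d y) : C ∈ N :=
  hN.mem_of_ext (h := hR) (n := 4) ![a, b, c, d] (by simp [Fin.forall_fin_succ, *])
    (fun v x => R (v 0) (v 1) (v 2) (v 3) x) hC hext

end

/-! ### Sets in `H θ` -/

section
variable {θ : Cardinal.{u}} {x y : ZFSet.{u}}

theorem H_subset (hx : x ∈ H θ) (h : y ⊆ x) : y ∈ H θ :=
  mem_H ((ZFSet.card_mono h).trans_lt hx.self) fun _ hz => H_trans hx (h hz)

theorem pair_H (hθ : ℵ₀ ≤ θ) (hx : x ∈ H θ) (hy : y ∈ H θ) : ZFSet.pair x y ∈ H θ := by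
  have h2 : ∀ a b : ZFSet.{u}, a ∈ H θ → b ∈ H θ → ({a, b} : ZFSet.{u}) ∈ H θ := fun a b ha hb =>
    mem_H (lt_of_le_of_lt (by simpa using ZFSet.card_insert_le (x := a) (y := {b}))
      (lt_of_lt_of_le (by simpa using add_lt_aleph0 one_lt_aleph0 one_lt_aleph0) hθ))
      (by simp [ha, hb])
  have : ({x} : ZFSet.{u}) = {x, x} := (ZFSet.pair_eq_singleton x).symm
  exact h2 _ _ (this ▸ h2 x x hx hx) (h2 _ _ hx hy)

theorem toZFSet_H {o : Ordinal.{u}} (ho : o.card < θ) : o.toZFSet ∈ H θ := by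
  induction o using WellFoundedLT.induction with
  | _ o ih =>
    refine mem_H (by simpa using ho) fun y hy => ?_
    obtain ⟨a, ha, rfl⟩ := Ordinal.mem_toZFSet_iff.1 hy
    exact ih a ha ((Ordinal.card_le_card ha.le).trans_lt ho)

theorem card_range_le {ι : Type u} (f : ι → ZFSet.{u}) : (ZFSet.range f).card ≤ #ι := by
  simpa using ZFSet.lift_card_range_le (f := f)

theorem mem_seq {i : Ordinal.{u}} {f : Ordinal.{u} → ZFSet.{u}} {p : ZFSet.{u}} :
    p ∈ seq i f ↔ ∃ j < i, p = ZFSet.pair j.toZFSet (f j) := by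
  simp [seq, eq_comm]

theorem pair_mem_seq {i : Ordinal.{u}} {f : Ordinal.{u} → ZFSet.{u}} {a y : ZFSet.{u}} :
    ZFSet.pair a y ∈ seq i f ↔ ∃ j < i, a = j.toZFSet ∧ y = f j := by
  simp [mem_seq, ZFSet.pair_inj]

theorem toZFSet_pair_mem_seq {i j : Ordinal.{u}} {f : Ordinal.{u} → ZFSet.{u}} {y : ZFSet.{u}} :
    ZFSet.pair j.toZFSet y ∈ seq i f ↔ j < i ∧ y = f j := by
  rw [pair_mem_seq]
  exact ⟨fun ⟨k, hk, h, e⟩ => by cases Ordinal.toZFSet_injective h; exact ⟨hk, e⟩,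
    fun ⟨h, e⟩ => ⟨j, h, rfl, e⟩⟩

theorem seq_congr {i : Ordinal.{u}} {f g : Ordinal.{u} → ZFSet.{u}} (h : ∀ j < i, f j = g j) :
    seq i f = seq i g := by
  ext p
  rw [mem_seq, mem_seq]
  exact exists_congr fun j => and_congr_right fun hj => by rw [h j hj]

theorem seq_inj {i : Ordinal.{u}} {f g : Ordinal.{u} → ZFSet.{u}} (h : seq i f = seq i g) :
    ∀ j < i, f j = g j := fun _ hj =>
  (toZFSet_pair_mem_seq.1 (h ▸ toZFSet_pair_mem_seq.2 ⟨hj, rfl⟩)).2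

theorem card_seq_le (i : Ordinal.{u}) (f : Ordinal.{u} → ZFSet.{u}) : (seq i f).card ≤ i.card := by
  rw [← Cardinal.lift_le.{u + 1}, ← ZFSet.cardinalMk_coe_sort, ← Cardinal.mk_Iio_ordinal]
  refine Cardinal.mk_le_of_surjective (f := fun j : Set.Iio i =>
    (⟨ZFSet.pair (j : Ordinal.{u}).toZFSet (f j), mem_seq.2 ⟨j, j.2, rfl⟩⟩ : seq i f)) ?_
  rintro ⟨p, hp⟩
  obtain ⟨j, hj, rfl⟩ := mem_seq.1 hp
  exact ⟨⟨j, hj⟩, rfl⟩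

theorem seq_H (hθ : ℵ₀ ≤ θ) {i : Ordinal.{u}} {f : Ordinal.{u} → ZFSet.{u}} (hi : i.card < θ)
    (hf : ∀ j < i, f j ∈ H θ) : seq i f ∈ H θ := by
  refine mem_H ((card_seq_le i f).trans_lt hi) fun p hp => ?_
  obtain ⟨j, hj, rfl⟩ := mem_seq.1 hp
  exact pair_H hθ (toZFSet_H ((Ordinal.card_le_card hj.le).trans_lt hi)) (hf j hj)

theorem isFunc_seq {i : Ordinal.{u}} {f : Ordinal.{u} → ZFSet.{u}} {B : ZFSet.{u}}
    (h : ∀ j < i, f j ∈ B) : ZFSet.IsFunc i.toZFSet B (seq i f) := by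
  constructor
  · intro p hp
    obtain ⟨j, hj, rfl⟩ := mem_seq.1 hp
    exact ZFSet.pair_mem_prod.2 ⟨Ordinal.toZFSet_mem_toZFSet_iff.2 hj, h j hj⟩
  · intro z hz
    obtain ⟨j, hj, rfl⟩ := Ordinal.mem_toZFSet_iff.1 hz
    exact ⟨f j, toZFSet_pair_mem_seq.2 ⟨hj, rfl⟩, fun y hy => (toZFSet_pair_mem_seq.1 hy).2⟩

theorem exists_eq_seq {i : Ordinal.{u}} {B h : ZFSet.{u}} (hh : ZFSet.IsFunc i.toZFSet B h) :
    ∃ f : Ordinal.{u} → ZFSet.{u}, h = seq i f ∧ ∀ j < i, f j ∈ B := by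
  have hex : ∀ j : Ordinal.{u}, ∃ y, j < i → ZFSet.pair j.toZFSet y ∈ h := fun j => by
    by_cases hj : j < i
    · obtain ⟨y, hy, -⟩ := hh.2 _ (Ordinal.toZFSet_mem_toZFSet_iff.2 hj)
      exact ⟨y, fun _ => hy⟩
    · exact ⟨∅, fun h => absurd h hj⟩
  choose f hf using hex
  refine ⟨f, ?_, fun j hj => (ZFSet.pair_mem_prod.1 (hh.1 (hf j hj))).2⟩
  ext p
  rw [mem_seq]
  constructor
  · intro hp
    obtain ⟨a, ha, b, hb, rfl⟩ := ZFSet.mem_prod.1 (hh.1 hp)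
    obtain ⟨j, hj, rfl⟩ := Ordinal.mem_toZFSet_iff.1 ha
    exact ⟨j, hj, by rw [(hh.2 _ ha).unique hp (hf j hj)]⟩
  · rintro ⟨j, hj, rfl⟩
    exact hf j hj

instance Dfn.isFunc {n : ℕ} {i j k : Fin n} :
    Dfn θ (fun v => ZFSet.IsFunc (v i) (v j) (v k)) :=
  Dfn.congr (P := fun v => (∀ p ∈ v k, ∃ a ∈ v i, ∃ y ∈ v j, p = ZFSet.pair a y) ∧
    ∀ a ∈ v i, ∃ y ∈ v j, ZFSet.pair a y ∈ v k ∧ ∀ y' ∈ v j, ZFSet.pair a y' ∈ v k → y' = y)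
    inferInstance fun v _ => by
      have h1 : v k ⊆ ZFSet.prod (v i) (v j) ↔
          ∀ p ∈ v k, ∃ a ∈ v i, ∃ y ∈ v j, p = ZFSet.pair a y :=
        forall₂_congr fun p _ => ZFSet.mem_prod
      rw [ZFSet.IsFunc, h1]
      refine and_congr_right fun h => forall₂_congr fun a _ => ?_
      have h2 : ∀ y, ZFSet.pair a y ∈ v k → y ∈ v j := fun y hy =>
        (ZFSet.pair_mem_prod.1 (h1.2 h hy)).2
      exact ⟨fun ⟨y, _, h3, h4⟩ => ⟨y, h3, fun y' hy' => h4 y' (h2 _ hy') hy'⟩,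
        fun ⟨y, h3, h4⟩ => ⟨y, h2 _ h3, h3, fun y' _ hy' => h4 y' hy'⟩⟩

/-- `k` restricts to a function from a subset of `d` onto `x`. -/
def SurjOnto (k d x : ZFSet.{u}) : Prop :=
  (∀ a ∈ d, ∀ y ∈ x, ∀ z ∈ x, ZFSet.pair a y ∈ k → ZFSet.pair a z ∈ k → y = z) ∧
    ∀ y ∈ x, ∃ a ∈ d, ZFSet.pair a y ∈ k

instance Dfn.surjOnto {n : ℕ} {i j k : Fin n} : Dfn θ (fun v => SurjOnto (v i) (v j) (v k)) :=
  Dfn.congr (P := fun v => (∀ a ∈ v j, ∀ y ∈ v k, ∀ z ∈ v k, ZFSet.pair a y ∈ v i →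
    ZFSet.pair a z ∈ v i → y = z) ∧ ∀ y ∈ v k, ∃ a ∈ v j, ZFSet.pair a y ∈ v i) inferInstance
    fun _ _ => Iff.rfl

theorem card_le_iff_exists_injective {x d : ZFSet.{u}} :
    x.card ≤ d.card ↔ ∃ g : x → d, Function.Injective g := by
  rw [← Cardinal.lift_le.{u + 1}]
  simp only [← ZFSet.cardinalMk_coe_sort, Cardinal.le_def]
  exact ⟨fun ⟨g⟩ => ⟨g, g.injective⟩, fun ⟨g, hg⟩ => ⟨⟨g, hg⟩⟩⟩

theorem SurjOnto.card_le {k d x : ZFSet.{u}} (h : SurjOnto k d x) : x.card ≤ d.card := by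
  rw [card_le_iff_exists_injective]
  have := fun y : x => h.2 y y.2
  choose g hg hgk using this
  refine ⟨fun y => ⟨g y, hg y⟩, fun y z hyz => Subtype.ext ?_⟩
  have e : g y = g z := congrArg Subtype.val hyz
  exact h.1 _ (hg y) _ y.2 _ z.2 (hgk y) (e ▸ hgk z)

theorem exists_surjOnto (hθ : ℵ₀ ≤ θ) {d x : ZFSet.{u}} (hd : d ∈ H θ) (hx : x ∈ H θ)
    (h : x.card ≤ d.card) : ∃ k ∈ H θ, SurjOnto k d x := by
  obtain ⟨g, hg⟩ := card_le_iff_exists_injective.1 h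
  let e : Shrink.{u} x ≃ x := (equivShrink _).symm
  have mem : ∀ a y : ZFSet.{u}, ZFSet.pair a y ∈
      ZFSet.range (fun s => ZFSet.pair (g (e s) : ZFSet.{u}) (e s)) ↔
        ∃ hy : y ∈ x, a = g ⟨y, hy⟩ := by
    intro a y
    simp only [ZFSet.mem_range, ZFSet.pair_inj]
    constructor
    · rintro ⟨s, h1, h2⟩
      subst h2
      exact ⟨(e s).2, h1.symm⟩
    · rintro ⟨hy, rfl⟩
      exact ⟨e.symm ⟨y, hy⟩, by simp, by simp⟩
  refine ⟨ZFSet.range (fun s => ZFSet.pair (g (e s) : ZFSet.{u}) (e s)), ?_, ?_, ?_⟩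
  · refine mem_H ((card_range_le _).trans_lt hx.self) fun p hp => ?_
    obtain ⟨s, rfl⟩ := ZFSet.mem_range.1 hp
    exact pair_H hθ (H_trans hd (g (e s)).2) (H_trans hx (e s).2)
  · intro a _ y _ z _ h1 h2
    obtain ⟨hy, h1⟩ := (mem _ _).1 h1
    obtain ⟨hz, h2⟩ := (mem _ _).1 h2
    exact congrArg Subtype.val (hg (Subtype.ext (h1.symm.trans h2)))
  · intro y hy
    exact ⟨g ⟨y, hy⟩, (g ⟨y, hy⟩).2, (mem _ _).2 ⟨hy, rfl⟩⟩

theorem exists_enum {lam : Cardinal.{u}} {A : ZFSet.{u}} (hne : A.Nonempty) (hA : A.card ≤ lam) :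
    ∃ X : Ordinal.{u} → ZFSet.{u}, ∀ y, y ∈ A ↔ ∃ a < lam.ord, X a = y := by
  have : A.card ≤ lam.ord.toZFSet.card := by simpa using hA
  obtain ⟨g, hg⟩ := card_le_iff_exists_injective.1 this
  obtain ⟨y₀, hy₀⟩ := hne
  have : Nonempty A := ⟨⟨y₀, hy₀⟩⟩
  classical
  refine ⟨fun a => if h : a.toZFSet ∈ lam.ord.toZFSet then
    (Function.invFun g ⟨_, h⟩ : A) else y₀, fun y => ⟨fun hy => ?_, ?_⟩⟩
  · obtain ⟨a, ha, e⟩ := Ordinal.mem_toZFSet_iff.1 (g ⟨y, hy⟩).2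
    have h2 : (⟨a.toZFSet, e ▸ (g ⟨y, hy⟩).2⟩ : lam.ord.toZFSet) = g ⟨y, hy⟩ :=
      Subtype.ext e
    refine ⟨a, ha, ?_⟩
    beta_reduce
    rw [dif_pos (e ▸ (g ⟨y, hy⟩).2), h2, Function.leftInverse_invFun hg]
  · rintro ⟨a, ha, rfl⟩
    beta_reduce
    rw [dif_pos (Ordinal.toZFSet_mem_toZFSet_iff.2 ha)]
    exact Subtype.prop _

end

/-! ### Membership and cardinality of `P_κ(λ)` -/

theorem mem_Pk {κ lam : Cardinal.{u}} {x : ZFSet.{u}} :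
    x ∈ Pk κ lam ↔ x ⊆ lam.ord.toZFSet ∧ x.card < κ := by
  simp [Pk]

theorem mem_cone {κ lam : Cardinal.{u}} {a : Ordinal.{u}} {x : ZFSet.{u}} :
    x ∈ cone κ lam a ↔ x ∈ Pk κ lam ∧ a.toZFSet ∈ x := by
  simp [cone]

theorem mem_diagInter {κ lam : Cardinal.{u}} {X : Ordinal.{u} → ZFSet.{u}} {x : ZFSet.{u}} :
    x ∈ diagInter κ lam X ↔ x ∈ Pk κ lam ∧ ∀ a < lam.ord, a.toZFSet ∈ x → x ∈ X a := by
  simp [diagInter]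

theorem mem_generated {κ lam : Cardinal.{u}} {N Y X : ZFSet.{u}} :
    X ∈ generated κ lam N Y ↔ X ∈ N ∧ X ⊆ Pk κ lam ∧ SubsetMod κ lam Y X := by
  simp [generated]

/-- Every `x` in `Pk κ lam` is the range of a function from the initial ordinal of its cardinality
into `λ`, which leaves at most `κ · λ^{<κ} = λ` possibilities. -/
theorem card_Pk_le {κ lam : Cardinal.{u}} (hκ : ℵ₀ ≤ κ) (hκlam : κ ≤ lam)
    (hpow : lam ^< κ = lam) : (Pk κ lam).card ≤ lam := by
  let ι := Shrink.{u} (Set.Iio κ.ord)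
  let o : ι → Ordinal.{u} := fun i => ((equivShrink _).symm i : Set.Iio κ.ord)
  have ho : ∀ i, (o i).card < κ := fun i => by
    have : o i < κ.ord := ((equivShrink (Set.Iio κ.ord)).symm i).2
    exact Cardinal.lt_ord.1 this
  have hι : #ι = κ := by
    have := Cardinal.mk_Iio_ordinal κ.ord
    rw [← Cardinal.lift_inj.{u, u + 1}, Cardinal.lift_mk_shrink'', this, card_ord]
  let F : (Σ i : ι, (o i).ToType → lam.ord.ToType) → ZFSet.{u} := fun p =>
    ZFSet.range (fun t => ((Ordinal.ToType.mk.symm (p.2 t) : Set.Iio lam.ord) :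
      Ordinal.{u}).toZFSet)
  have hsub : Pk κ lam ⊆ ZFSet.range F := by
    intro x hx
    obtain ⟨hx, hc⟩ := mem_Pk.1 hx
    let i : ι := equivShrink _ ⟨x.card.ord, by simpa using Cardinal.ord_lt_ord.2 hc⟩
    have hi : o i = x.card.ord := by simp [o, i]
    have hcard : #(o i).ToType = #(Shrink.{u} x) := by rw [Cardinal.mk_toType, hi, card_ord]; rfl
    obtain ⟨e⟩ := Cardinal.eq.1 hcard
    have hy : ∀ t, ∃ a : Set.Iio lam.ord,
        (a : Ordinal.{u}).toZFSet = ((equivShrink x).symm (e t) : ZFSet.{u}) := fun t => by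
      obtain ⟨a, ha, h⟩ := Ordinal.mem_toZFSet_iff.1 (hx ((equivShrink x).symm (e t)).2)
      exact ⟨⟨a, ha⟩, h⟩
    choose g hg using hy
    refine ZFSet.mem_range.2 ⟨⟨i, fun t => Ordinal.ToType.mk (g t)⟩, ?_⟩
    ext y
    simp only [F, ZFSet.mem_range, OrderIso.symm_apply_apply, hg]
    constructor
    · rintro ⟨t, rfl⟩
      exact ((equivShrink x).symm (e t)).2
    · intro hy
      exact ⟨e.symm (equivShrink x ⟨y, hy⟩), by simp⟩
  refine (ZFSet.card_mono hsub).trans ((card_range_le _).trans ?_)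
  rw [Cardinal.mk_sigma]
  refine (Cardinal.sum_le_sum _ (fun _ => lam) fun i => ?_).trans ?_
  · rw [← Cardinal.power_def, Cardinal.mk_toType, Cardinal.mk_toType, card_ord]
    exact (Cardinal.le_powerlt lam (ho i)).trans hpow.le
  · rw [Cardinal.sum_const', hι]
    exact Cardinal.mul_le_of_le (hκ.trans hκlam) hκlam le_rfl

/-! ### Closure properties of models -/

/-- The standing assumptions on the cardinals. -/
structure Admissible (κ lam θ : Cardinal.{u}) : Prop where
  aleph0_le : ℵ₀ ≤ κ
  le : κ ≤ lam
  pow : lam ^< κ = lam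
  lt : lam < θ

section
variable {κ lam θ : Cardinal.{u}} {N x y A h : ZFSet.{u}}

theorem Admissible.aleph0_le_lam (hp : Admissible κ lam θ) : ℵ₀ ≤ lam := hp.aleph0_le.trans hp.le

theorem Admissible.aleph0_le_theta (hp : Admissible κ lam θ) : ℵ₀ ≤ θ :=
  hp.aleph0_le_lam.trans hp.lt.le

theorem Admissible.card_Pk (hp : Admissible κ lam θ) : (Pk κ lam).card ≤ lam :=
  card_Pk_le hp.aleph0_le hp.le hp.pow

theorem Admissible.lam_H (hp : Admissible κ lam θ) : lam.ord.toZFSet ∈ H θ :=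
  toZFSet_H (by simpa using hp.lt)

theorem Admissible.Pk_H (hp : Admissible κ lam θ) : Pk κ lam ∈ H θ :=
  mem_H (hp.card_Pk.trans_lt hp.lt) fun _ hx => H_subset hp.lam_H (mem_Pk.1 hx).1

theorem pair_mem_H (hxy : ZFSet.pair x y ∈ H θ) : x ∈ H θ ∧ y ∈ H θ := by
  have h2 : ({x, y} : ZFSet.{u}) ∈ H θ := H_trans hxy (by simp [ZFSet.pair])
  exact ⟨H_trans h2 (by simp), H_trans h2 (by simp)⟩

namespace IsModel
variable (hN : IsModel κ lam θ N)
include hN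

theorem mem_H_of_mem (hx : x ∈ N) : x ∈ H θ := hN.elem.1 hx

theorem mem_H (hp : Admissible κ lam θ) : N ∈ H θ :=
  FilterGame.mem_H (hN.card_eq.trans_lt hp.lt) fun _ hx => hN.mem_H_of_mem hx

theorem ord_mem {a : Ordinal.{u}} (ha : a ≤ lam.ord) : a.toZFSet ∈ N :=
  hN.ordinal_subset (Ordinal.toZFSet_mem_toZFSet_iff.2 (Order.lt_succ_of_le ha))

theorem pair_mem (hxy : ZFSet.pair x y ∈ N) : x ∈ N ∧ y ∈ N := by
  obtain ⟨hx, hy⟩ := pair_mem_H (hN.mem_H_of_mem hxy)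
  constructor
  · obtain ⟨z, hz, w, _, e⟩ := hN.elem.reflect₂
      (fun p _ z => ∃ w ∈ H θ, p = ZFSet.pair z w) hxy hxy ⟨x, hx, y, hy, rfl⟩
    exact (ZFSet.pair_inj.1 e).1 ▸ hz
  · obtain ⟨z, hz, w, _, e⟩ := hN.elem.reflect₂
      (fun p _ z => ∃ w ∈ H θ, p = ZFSet.pair w z) hxy hxy ⟨y, hy, x, hx, rfl⟩
    exact (ZFSet.pair_inj.1 e).2 ▸ hz

theorem seq_apply_mem {i j : Ordinal.{u}} {f : Ordinal.{u} → ZFSet.{u}} (hf : seq i f ∈ N)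
    (hj : j < i) (hjN : j.toZFSet ∈ N) : f j ∈ N := by
  have hp : ZFSet.pair j.toZFSet (f j) ∈ seq i f := toZFSet_pair_mem_seq.2 ⟨hj, rfl⟩
  obtain ⟨y, hy, hyp⟩ := hN.elem.reflect₂ (fun a h y => ZFSet.pair a y ∈ h) hjN hf
    ⟨f j, (pair_mem_H (H_trans (hN.mem_H_of_mem hf) hp)).2, hp⟩
  exact (toZFSet_pair_mem_seq.1 hyp).2 ▸ hy

/-- `H θ` contains an enumeration of `A` in length `λ`; since `λ` and `A` are in `N`, elementarity
gives one in `N`. -/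
theorem exists_enum (hp : Admissible κ lam θ) (hA : A ∈ N) (hne : A.Nonempty) (hc : A.card ≤ lam) :
    ∃ X : Ordinal.{u} → ZFSet.{u}, seq lam.ord X ∈ N ∧ ∀ y, y ∈ A ↔ ∃ a < lam.ord, X a = y := by
  obtain ⟨X, hX⟩ := FilterGame.exists_enum hne hc
  have hXA : ∀ a < lam.ord, X a ∈ A := fun a ha => (hX _).2 ⟨a, ha, rfl⟩
  obtain ⟨h, hh, hf, hs⟩ := hN.elem.reflect₂
    (fun l A h => ZFSet.IsFunc l A h ∧ ∀ y ∈ A, ∃ a ∈ l, ZFSet.pair a y ∈ h)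
    (hN.ord_mem le_rfl) hA ⟨seq lam.ord X, seq_H hp.aleph0_le_theta (by simpa using hp.lt)
      fun j hj => H_trans (hN.mem_H_of_mem hA) (hXA j hj), isFunc_seq hXA, fun y hy => by
        obtain ⟨a, ha, rfl⟩ := (hX y).1 hy
        exact ⟨_, Ordinal.toZFSet_mem_toZFSet_iff.2 ha, toZFSet_pair_mem_seq.2 ⟨ha, rfl⟩⟩⟩
  obtain ⟨f, rfl, hfA⟩ := exists_eq_seq hf
  refine ⟨f, hh, fun y => ⟨fun hy => ?_, ?_⟩⟩
  · obtain ⟨a, _, hay⟩ := hs y hy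
    obtain ⟨j, hj, _, e⟩ := pair_mem_seq.1 hay
    exact ⟨j, hj, e.symm⟩
  · rintro ⟨a, ha, rfl⟩
    exact hfA a ha

theorem subset_of_card_le (hp : Admissible κ lam θ) (hA : A ∈ N) (hc : A.card ≤ lam) : A ⊆ N := by
  intro y hy
  obtain ⟨X, hX, hXA⟩ := hN.exists_enum hp hA ⟨y, hy⟩ hc
  obtain ⟨a, ha, rfl⟩ := (hXA y).1 hy
  exact hN.seq_apply_mem hX ha (hN.ord_mem ha.le)

theorem of_seq_mem (hp : Admissible κ lam θ) {i j : Ordinal.{u}} {f : Ordinal.{u} → ZFSet.{u}}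
    (hf : seq i f ∈ N) (hi : i.card ≤ lam) (hj : j < i) : j.toZFSet ∈ N ∧ f j ∈ N :=
  hN.pair_mem (hN.subset_of_card_le hp hf ((card_seq_le i f).trans hi)
    (toZFSet_pair_mem_seq.2 ⟨hj, rfl⟩))

theorem inter_mem (hx : x ∈ N) (hy : y ∈ N) : x ∩ y ∈ N :=
  hN.elem.mem_of_ext₂ (fun x y z => z ∈ x ∧ z ∈ y) hx hy
    (H_subset (hN.mem_H_of_mem hx) fun _ hz => (ZFSet.mem_inter.1 hz).1) (by simp)

theorem sdiff_mem (hx : x ∈ N) (hy : y ∈ N) : x \ y ∈ N :=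
  hN.elem.mem_of_ext₂ (fun x y z => z ∈ x ∧ ¬ z ∈ y) hx hy
    (H_subset (hN.mem_H_of_mem hx) fun _ hz => (ZFSet.mem_sdiff.1 hz).1) (by simp)

/-- Being smaller than `μ` is expressed by a surjection from an element of `μ`, and `H θ` contains
all the surjections needed. The case `μ = ℵ₀` provides the finite sets that describe the fine
filter. -/
theorem Pk_mem (hp : Admissible κ lam θ) {μ : Cardinal.{u}} (hμ : μ ≤ κ) : Pk μ lam ∈ N := by
  have hμl : μ.ord ≤ lam.ord := Cardinal.ord_le_ord.2 (hμ.trans hp.le)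
  refine hN.elem.mem_of_ext₂ (fun l m x => x ⊆ l ∧ ∃ a ∈ m, ∃ k ∈ H θ, SurjOnto k a x)
    (hN.ord_mem le_rfl) (hN.ord_mem hμl)
    (H_subset hp.Pk_H fun x hx => mem_Pk.2 ((mem_Pk.1 hx).imp_right fun h => h.trans_le hμ))
    fun x hx => ?_
  rw [mem_Pk]
  refine and_congr_right fun _ => ⟨fun hc => ?_, ?_⟩
  · refine ⟨x.card.ord.toZFSet, Ordinal.toZFSet_mem_toZFSet_iff.2 (Cardinal.ord_lt_ord.2 hc), ?_⟩
    exact exists_surjOnto hp.aleph0_le_theta (toZFSet_H (by simpa using hx.self)) hx (by simp)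
  · rintro ⟨a, ha, k, _, hk⟩
    obtain ⟨o, ho, rfl⟩ := Ordinal.mem_toZFSet_iff.1 ha
    exact (hk.card_le.trans_eq (by simp)).trans_lt (Cardinal.lt_ord.1 ho)

theorem cone_mem (hp : Admissible κ lam θ) {a : Ordinal.{u}} (ha : a < lam.ord) :
    cone κ lam a ∈ N :=
  hN.elem.mem_of_ext₂ (fun a p x => x ∈ p ∧ a ∈ x) (hN.ord_mem ha.le) (hN.Pk_mem hp le_rfl)
    (H_subset hp.Pk_H fun _ hx => (mem_cone.1 hx).1) fun _ _ => mem_cone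

theorem diagInter_mem (hp : Admissible κ lam θ) {X : Ordinal.{u} → ZFSet.{u}}
    (hX : seq lam.ord X ∈ N) : diagInter κ lam X ∈ N := by
  refine hN.elem.mem_of_ext₃
    (fun l p h x => x ∈ p ∧ ∀ a ∈ l, a ∈ x → ∀ y ∈ H θ, ZFSet.pair a y ∈ h → x ∈ y)
    (hN.ord_mem le_rfl) (hN.Pk_mem hp le_rfl) hX
    (H_subset hp.Pk_H fun _ hx => (mem_diagInter.1 hx).1) fun x _ => ?_
  rw [mem_diagInter]
  refine and_congr_right fun _ => ⟨fun H a ha hax y _ hy => ?_, fun H a ha hax => ?_⟩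
  · obtain ⟨j, hj, rfl, rfl⟩ := pair_mem_seq.1 hy
    exact H j hj hax
  · have : ZFSet.pair a.toZFSet (X a) ∈ seq lam.ord X := toZFSet_pair_mem_seq.2 ⟨ha, rfl⟩
    exact H _ (Ordinal.toZFSet_mem_toZFSet_iff.2 ha) hax _
      (pair_mem_H (H_trans (hN.mem_H_of_mem hX) this)).2 this

end IsModel

/-! ### The fine filter -/

theorem finite_of_mem_Pk {s : ZFSet.{u}} (hs : s ∈ Pk ℵ₀ lam) : (s : Set ZFSet.{u}).Finite := by
  have h := (mem_Pk.1 hs).2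
  rw [← Cardinal.lift_lt.{u, u + 1}, ← ZFSet.cardinalMk_coe_sort, Cardinal.lift_aleph0] at h
  exact Cardinal.lt_aleph0_iff_set_finite.1 h

theorem exists_finite_of_mem_fineFilter {S : Set ZFSet.{u}} (hS : S ∈ fineFilter κ lam) :
    ∃ s ∈ Pk ℵ₀ lam, ∀ x ∈ Pk κ lam, s ⊆ x → x ∈ S := by
  induction hS with
  | basic h =>
    obtain ⟨a, ha, rfl⟩ := h
    refine ⟨{a.toZFSet}, mem_Pk.2 ⟨?_, by simp⟩, fun x hx hs => mem_cone.2 ⟨hx, hs (by simp)⟩⟩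
    intro y hy
    rw [ZFSet.mem_singleton.1 hy]
    exact Ordinal.toZFSet_mem_toZFSet_iff.2 ha
  | univ => exact ⟨∅, mem_Pk.2 ⟨ZFSet.empty_subset _, by simp [Cardinal.aleph0_pos]⟩, fun _ _ _ => trivial⟩
  | superset _ hST ih =>
    obtain ⟨s, hs, h⟩ := ih
    exact ⟨s, hs, fun x hx hsx => hST (h x hx hsx)⟩
  | inter _ _ ih₁ ih₂ =>
    obtain ⟨s, hs, h⟩ := ih₁
    obtain ⟨t, ht, h'⟩ := ih₂
    rw [mem_Pk] at hs ht
    refine ⟨s ∪ t, mem_Pk.2 ⟨fun y hy => ?_, ?_⟩, fun x hx hst => ⟨h x hx fun y hy => ?_,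
      h' x hx fun y hy => ?_⟩⟩
    · exact (ZFSet.mem_union.1 hy).elim (fun h => hs.1 h) (fun h => ht.1 h)
    · exact ZFSet.card_union_le.trans_lt (add_lt_aleph0 hs.2 ht.2)
    · exact hst (ZFSet.mem_union.2 (Or.inl hy))
    · exact hst (ZFSet.mem_union.2 (Or.inr hy))

theorem finite_mem_fineFilter {s : ZFSet.{u}} (hs : s ∈ Pk ℵ₀ lam) :
    {x : ZFSet.{u} | s ⊆ x} ∈ fineFilter κ lam := by
  have : (⋂ a ∈ (s : Set ZFSet.{u}), {x : ZFSet.{u} | a ∈ x}) ∈ fineFilter κ lam := by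
    refine (Filter.biInter_mem (finite_of_mem_Pk hs)).2 fun a ha => ?_
    obtain ⟨o, ho, rfl⟩ := Ordinal.mem_toZFSet_iff.1 ((mem_Pk.1 hs).1 ha)
    exact Filter.mem_of_superset (Filter.GenerateSets.basic ⟨o, ho, rfl⟩)
      fun x hx => (mem_cone.1 hx).2
  refine Filter.mem_of_superset this fun x hx a ha => ?_
  exact Set.mem_iInter₂.1 hx a ha

/-- The filter lives on the proper class of all sets; a finite subset of `λ` as witness makes the
relation definable over `H θ`. -/
theorem subsetMod_iff {X Y : ZFSet.{u}} (hY : Y ⊆ Pk κ lam) :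
    SubsetMod κ lam Y X ↔ ∃ s ∈ Pk ℵ₀ lam, ∀ x ∈ Y, s ⊆ x → x ∈ X := by
  constructor
  · rintro ⟨A, hA, h⟩
    obtain ⟨s, hs, hsA⟩ := exists_finite_of_mem_fineFilter hA
    exact ⟨s, hs, fun x hx hsx => h x hx (hsA x (hY hx) hsx)⟩
  · rintro ⟨s, hs, h⟩
    exact ⟨_, finite_mem_fineFilter hs, fun x hx hsx => h x hx hsx⟩

theorem SubsetMod.refl (Y : ZFSet.{u}) : SubsetMod κ lam Y Y :=
  ⟨Set.univ, Filter.univ_mem, fun _ h _ => h⟩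

theorem SubsetMod.trans {X Y Z : ZFSet.{u}} (h₁ : SubsetMod κ lam X Y) (h₂ : SubsetMod κ lam Y Z) :
    SubsetMod κ lam X Z := by
  obtain ⟨A, hA, h₁⟩ := h₁
  obtain ⟨B, hB, h₂⟩ := h₂
  exact ⟨A ∩ B, Filter.inter_mem hA hB, fun x hx hAB => h₂ x (h₁ x hx hAB.1) hAB.2⟩

theorem SubsetMod.empty_of_sdiff {X Y P : ZFSet.{u}} (h₁ : SubsetMod κ lam Y X)
    (h₂ : SubsetMod κ lam Y (P \ X)) : SubsetMod κ lam Y ∅ := by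
  obtain ⟨A, hA, h₁⟩ := h₁
  obtain ⟨B, hB, h₂⟩ := h₂
  exact ⟨A ∩ B, Filter.inter_mem hA hB, fun x hx hAB =>
    absurd (h₁ x hx hAB.1) (ZFSet.mem_sdiff.1 (h₂ x hx hAB.2)).2⟩

theorem IsModel.generated_mem (hN : IsModel κ lam θ N) (hp : Admissible κ lam θ)
    {N' Y : ZFSet.{u}} (hN' : N' ∈ N) (hY : Y ∈ N) (hYP : Y ⊆ Pk κ lam) :
    generated κ lam N' Y ∈ N := by
  refine hN.elem.mem_of_ext₄ (fun M P F Y X => X ∈ M ∧ X ⊆ P ∧ ∃ s ∈ F, ∀ x ∈ Y, s ⊆ x → x ∈ X)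
    hN' (hN.Pk_mem hp le_rfl) (hN.Pk_mem hp hp.aleph0_le) hY
    (H_subset (hN.mem_H_of_mem hN') fun _ hX => (mem_generated.1 hX).1) fun X _ => ?_
  rw [mem_generated, subsetMod_iff hYP]

/-! ### Normal ultrafilters -/

theorem IsNormalUltrafilter.card_le {U : ZFSet.{u}} (hU : IsNormalUltrafilter κ lam N U)
    (hN : IsModel κ lam θ N) : U.card ≤ lam :=
  (ZFSet.card_mono fun X hX => (hU.subset X hX).1).trans_eq hN.card_eq

/-- Intersecting `Y` with finitely many cones stays inside `U`, and members of `U` are nonempty. -/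
theorem IsNormalUltrafilter.finite_cone_mem {U : ZFSet.{u}} (hU : IsNormalUltrafilter κ lam N U)
    {Y s : ZFSet.{u}} (hY : Y ∈ U) (hs : s ∈ Pk ℵ₀ lam) : ∃ x ∈ Y, s ⊆ x := by
  have key : ∀ t : Set ZFSet.{u}, t.Finite → t ⊆ lam.ord.toZFSet →
      ∃ Z ∈ U, Z ⊆ Y ∧ ∀ x ∈ Z, ∀ a ∈ t, a ∈ x := by
    intro t ht
    induction t, ht using Set.Finite.induction_on with
    | empty => exact fun _ => ⟨Y, hY, fun _ h => h, by simp⟩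
    | @insert a t _ _ ih =>
      intro hsub
      obtain ⟨Z, hZ, hZY, h⟩ := ih ((Set.subset_insert _ _).trans hsub)
      obtain ⟨o, ho, rfl⟩ := Ordinal.mem_toZFSet_iff.1 (hsub (Set.mem_insert _ _))
      refine ⟨Z ∩ cone κ lam o, hU.inter_mem _ hZ _ (hU.fine o ho),
        fun x hx => hZY (ZFSet.mem_inter.1 hx).1, fun x hx a ha => ?_⟩
      obtain ⟨h1, h2⟩ := ZFSet.mem_inter.1 hx
      rcases ha with rfl | ha
      · exact (mem_cone.1 h2).2
      · exact h x h1 a ha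
  obtain ⟨Z, hZ, hZY, h⟩ := key s (finite_of_mem_Pk hs) (mem_Pk.1 hs).1
  obtain rfl | ⟨x, hx⟩ := Z.eq_empty_or_nonempty
  · exact absurd hZ hU.empty_notMem
  · exact ⟨x, hZY hx, fun a ha => h x hx a ha⟩

theorem not_subsetMod_empty {Y : ZFSet.{u}} (hY : Y ⊆ Pk κ lam)
    (h : ∀ s ∈ Pk ℵ₀ lam, ∃ x ∈ Y, s ⊆ x) : ¬ SubsetMod κ lam Y ∅ := fun hs => by
  obtain ⟨s, hs, H⟩ := (subsetMod_iff hY).1 hs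
  obtain ⟨x, hx, hsx⟩ := h s hs
  exact ZFSet.notMem_empty _ (H x hx hsx)

theorem IsNormalUltrafilter.inter {U N' : ZFSet.{u}} (hU : IsNormalUltrafilter κ lam N' U)
    (hp : Admissible κ lam θ) (hN : IsModel κ lam θ N) (hsub : N ⊆ N') :
    IsNormalUltrafilter κ lam N (U ∩ N) where
  subset X hX := ⟨(ZFSet.mem_inter.1 hX).2, (hU.subset X (ZFSet.mem_inter.1 hX).1).2⟩
  univ_mem := ZFSet.mem_inter.2 ⟨hU.univ_mem, hN.Pk_mem hp le_rfl⟩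
  empty_notMem h := hU.empty_notMem (ZFSet.mem_inter.1 h).1
  inter_mem X hX Y hY := by
    rw [ZFSet.mem_inter] at *
    exact ⟨hU.inter_mem X hX.1 Y hY.1, hN.inter_mem hX.2 hY.2⟩
  mem_of_superset X hX Y hY hXY hYP := by
    rw [ZFSet.mem_inter] at *
    exact ⟨hU.mem_of_superset X hX.1 Y (hsub hY) hXY hYP, hY⟩
  measures X hX hXP := by
    simp only [ZFSet.mem_inter]
    exact (hU.measures X (hsub hX) hXP).imp (fun h => ⟨h, hX⟩)
      fun h => ⟨h, hN.sdiff_mem (hN.Pk_mem hp le_rfl) hX⟩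
  fine a ha := ZFSet.mem_inter.2 ⟨hU.fine a ha, hN.cone_mem hp ha⟩
  normal X hX hXU := ZFSet.mem_inter.2 ⟨hU.normal X (hsub hX) fun a ha =>
    (ZFSet.mem_inter.1 (hXU a ha)).1, hN.diagInter_mem hp hX⟩

/-- If `Y ⊆_F X` but the complement of `X` were in `U`, then `Y` would be contained in both modulo
the fine filter, hence in `∅`. -/
theorem generated_eq_inter {U N' Y : ZFSet.{u}} (hU : IsNormalUltrafilter κ lam N' U)
    (hp : Admissible κ lam θ) (hN : IsModel κ lam θ N) (hsub : N ⊆ N')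
    (hYU : ∀ X ∈ U, X ∈ N → SubsetMod κ lam Y X) (hY : ¬ SubsetMod κ lam Y ∅) :
    generated κ lam N Y = U ∩ N := by
  ext X
  rw [mem_generated, ZFSet.mem_inter]
  constructor
  · rintro ⟨hXN, hXP, hYX⟩
    refine ⟨(hU.measures X (hsub hXN) hXP).resolve_right fun h => hY ?_, hXN⟩
    exact hYX.empty_of_sdiff (hYU _ h (hN.sdiff_mem (hN.Pk_mem hp le_rfl) hXN))
  · exact fun h => ⟨h.2, (hU.subset X h.1).2, hYU X h.1 h.2⟩

end

/-! ### Sets generating normal ultrafilters -/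

section
variable {κ lam θ : Cardinal.{u}} {N Y : ZFSet.{u}}

theorem exists_notMem_of_mem_Pk (hp : Admissible κ lam θ) {x : ZFSet.{u}} (hx : x ∈ Pk κ lam) :
    ∃ b < lam.ord, b.toZFSet ∉ x := by
  by_contra! H
  have h1 : lam.ord.toZFSet ⊆ x := fun y hy => by
    obtain ⟨b, hb, rfl⟩ := Ordinal.mem_toZFSet_iff.1 hy
    exact H b hb
  have h2 := (ZFSet.card_mono h1).trans_lt ((mem_Pk.1 hx).2.trans_le hp.le)
  simp at h2

theorem singleton_mem_Pk_aleph0 {b : Ordinal.{u}} (hb : b < lam.ord) :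
    ({b.toZFSet} : ZFSet.{u}) ∈ Pk ℵ₀ lam :=
  mem_Pk.2 ⟨fun y hy => by
    rw [ZFSet.mem_singleton.1 hy]
    exact Ordinal.toZFSet_mem_toZFSet_iff.2 hb, by simp⟩

theorem insert_mem_Pk_aleph0 {b : Ordinal.{u}} (hb : b < lam.ord) {s : ZFSet.{u}}
    (hs : s ∈ Pk ℵ₀ lam) : insert b.toZFSet s ∈ Pk ℵ₀ lam := by
  rw [mem_Pk] at *
  refine ⟨fun y hy => ?_, ZFSet.card_insert_le.trans_lt (add_lt_aleph0 hs.2 one_lt_aleph0)⟩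
  rcases ZFSet.mem_insert_iff.1 hy with rfl | hy
  · exact Ordinal.toZFSet_mem_toZFSet_iff.2 hb
  · exact hs.1 hy

theorem Admissible.exists_enum_finite (hp : Admissible κ lam θ) :
    ∃ S : Ordinal.{u} → ZFSet.{u}, ∀ s, s ∈ Pk ℵ₀ lam ↔ ∃ a < lam.ord, S a = s :=
  FilterGame.exists_enum ⟨∅, mem_Pk.2 ⟨ZFSet.empty_subset _, by simp [Cardinal.aleph0_pos]⟩⟩
    ((ZFSet.card_mono fun _ hx => mem_Pk.2 ((mem_Pk.1 hx).imp_right fun h =>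
      h.trans_le hp.aleph0_le)).trans hp.card_Pk)

theorem IsModel.seq_sdiff_mem (hN : IsModel κ lam θ N) (hp : Admissible κ lam θ)
    {f : Ordinal.{u} → ZFSet.{u}} (hf : seq lam.ord f ∈ N) :
    seq lam.ord (fun a => Pk κ lam \ {f a}) ∈ N := by
  have hf' : ∀ j < lam.ord, f j ∈ H θ := fun j hj =>
    hN.mem_H_of_mem (hN.of_seq_mem hp hf (by simp) hj).2
  have hsub : ∀ x, Pk κ lam \ {x} ∈ H θ := fun x =>
    H_subset hp.Pk_H fun _ hz => (ZFSet.mem_sdiff.1 hz).1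
  refine hN.elem.mem_of_ext₃ (fun l P h p => ∃ a ∈ l, ∃ x ∈ H θ, ∃ z ∈ H θ, ZFSet.pair a x ∈ h ∧
      (∀ y ∈ H θ, y ∈ z ↔ y ∈ P ∧ ¬ y = x) ∧ p = ZFSet.pair a z)
    (hN.ord_mem le_rfl) (hN.Pk_mem hp le_rfl) hf
    (seq_H hp.aleph0_le_theta (by simpa using hp.lt) fun j _ => hsub _) fun p hpH => ?_
  rw [mem_seq]
  constructor
  · rintro ⟨j, hj, rfl⟩
    exact ⟨_, Ordinal.toZFSet_mem_toZFSet_iff.2 hj, f j, hf' j hj, _, hsub (f j),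
      toZFSet_pair_mem_seq.2 ⟨hj, rfl⟩, fun y _ => by simp, rfl⟩
  · rintro ⟨a, _, x, hx, z, hz, hax, hzx, rfl⟩
    obtain ⟨j, hj, rfl, rfl⟩ := pair_mem_seq.1 hax
    refine ⟨j, hj, congrArg _ (ZFSet.ext fun y => ?_)⟩
    rw [ZFSet.mem_sdiff, ZFSet.mem_singleton]
    exact ⟨fun hy => (hzx y (H_trans hz hy)).1 hy, fun hy => (hzx y (H_trans hp.Pk_H hy.1)).2 hy⟩

/-- A set that generates a normal `N`-ultrafilter modulo the fine filter is not in `N`. -/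
theorem IsModel.not_normal_generated (hN : IsModel κ lam θ N) (hp : Admissible κ lam θ)
    (hY : Y ∈ N) (hYP : Y ⊆ Pk κ lam) :
    ¬ IsNormalUltrafilter κ lam N (generated κ lam N Y) := fun hU => by
  have hYU : Y ∈ generated κ lam N Y := mem_generated.2 ⟨hY, hYP, SubsetMod.refl Y⟩
  obtain ⟨S, hS⟩ := hp.exists_enum_finite
  -- The chosen `x ∈ Y` contains both `a` and the `a`-th finite set, so the choices meet every
  -- finite cone. Outside `λ` an arbitrary element of `Y` serves as default.
  have hex : ∀ a : Ordinal.{u}, ∃ x ∈ Y, a < lam.ord → a.toZFSet ∈ x ∧ S a ⊆ x := fun a => by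
    by_cases ha : a < lam.ord
    · obtain ⟨x, hx, h⟩ := hU.finite_cone_mem hYU
        (insert_mem_Pk_aleph0 ha ((hS _).2 ⟨a, ha, rfl⟩))
      exact ⟨x, hx, fun _ => ⟨h (ZFSet.mem_insert _ _),
        fun y hy => h (ZFSet.mem_insert_of_mem _ hy)⟩⟩
    · obtain ⟨x, hx, -⟩ := hU.finite_cone_mem hYU ((hS (S 0)).2 ⟨0, by
        simpa using hp.aleph0_le_lam.trans_lt' Cardinal.aleph0_pos, rfl⟩)
      exact ⟨x, hx, fun h => absurd h ha⟩
  choose g hgY hg using hex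
  have hYH := hN.mem_H_of_mem hY
  -- The choice function just built need not lie in `N`; elementarity replaces it by one in `N` with
  -- the same two properties.
  obtain ⟨h, hh, hF, h1, h2⟩ := hN.elem.reflect₃
    (fun l F Y h => ZFSet.IsFunc l Y h ∧ (∀ a ∈ l, ∀ y ∈ Y, ZFSet.pair a y ∈ h → a ∈ y) ∧
      ∀ s ∈ F, ∃ a ∈ l, ∃ y ∈ Y, ZFSet.pair a y ∈ h ∧ s ⊆ y)
    (hN.ord_mem le_rfl) (hN.Pk_mem hp hp.aleph0_le) hY
    ⟨seq lam.ord g, seq_H hp.aleph0_le_theta (by simpa using hp.lt) fun j _ => H_trans hYH (hgY j),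
      isFunc_seq fun j _ => hgY j, fun a _ y _ hay => by
        obtain ⟨j, hj, rfl, rfl⟩ := pair_mem_seq.1 hay
        exact (hg j hj).1, fun s hs => by
        obtain ⟨a, ha, rfl⟩ := (hS s).1 hs
        exact ⟨_, Ordinal.toZFSet_mem_toZFSet_iff.2 ha, g a, hgY a,
          toZFSet_pair_mem_seq.2 ⟨ha, rfl⟩, (hg a ha).2⟩⟩
  obtain ⟨f, rfl, hfY⟩ := exists_eq_seq hF
  have hX := hN.seq_sdiff_mem hp hh
  -- By fineness no singleton `{f a}` belongs to the ultrafilter: some `b < λ` is not in `f a`.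
  have hXU : ∀ a < lam.ord, Pk κ lam \ {f a} ∈ generated κ lam N Y := fun a ha => by
    refine (hU.measures _ (hN.of_seq_mem hp hX (by simp) ha).2 fun z hz =>
      (ZFSet.mem_sdiff.1 hz).1).resolve_right fun H => ?_
    obtain ⟨b, hb, hbf⟩ := exists_notMem_of_mem_Pk hp (hYP (hfY a ha))
    obtain ⟨x, hx, hbx⟩ := hU.finite_cone_mem H (singleton_mem_Pk_aleph0 hb)
    have : x = f a := by
      by_contra hne
      have := ZFSet.mem_sdiff.1 hx
      exact this.2 (ZFSet.mem_sdiff.2 ⟨this.1, by simpa using hne⟩)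
    subst this
    exact hbf (hbx (ZFSet.mem_singleton.2 rfl))
  -- By normality `Y` is contained in the diagonal intersection above some finite `s`. A value `f j
  -- ⊇ s` with `j ∈ f j` then has to differ from itself.
  obtain ⟨s, hs, H⟩ := (subsetMod_iff hYP).1 (mem_generated.1 (hU.normal _ hX hXU)).2.2
  obtain ⟨a, ha, y, hy, hay, hsy⟩ := h2 s hs
  obtain ⟨j, hj, rfl, rfl⟩ := pair_mem_seq.1 hay
  have := (mem_diagInter.1 (H _ hy hsy)).2 j hj (h1 _ ha _ hy hay)
  simp at this

/-! ### Pseudo-intersections -/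

/-- König's theorem gives `λ < λ^{cf λ}`, which contradicts `λ^{<λ} = λ` if `cf λ < λ`. -/
theorem Admissible.isRegular (hp : Admissible lam lam θ) : lam.IsRegular := by
  refine ⟨hp.aleph0_le, le_of_not_gt fun h => ?_⟩
  exact ((Cardinal.le_powerlt lam h).trans hp.pow.le).not_gt (Cardinal.lt_power_cof_ord hp.aleph0_le)

/-- Fewer than `λ` sets of size less than `κ` do not cover `λ`: by counting if `κ < λ`, and by
regularity of `λ` if `κ = λ`. -/
theorem exists_notMem_of_family (hp : Admissible κ lam θ) {b : Ordinal.{u}} (hb : b < lam.ord)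
    (y : Ordinal.{u} → ZFSet.{u}) (hy : ∀ a, y a ∈ Pk κ lam) :
    ∃ c < lam.ord, ∀ a ≤ b, c.toZFSet ∉ y a := by
  let ι := (Order.succ b).ToType
  let f : ι → ZFSet.{u} := fun t => y (Ordinal.ToType.mk.symm t : Set.Iio (Order.succ b))
  have hι : #ι < lam := by
    rw [Cardinal.mk_toType, ← Cardinal.lt_ord]
    exact (Cardinal.isSuccLimit_ord hp.aleph0_le_lam).succ_lt hb
  have hfc : ∀ t, (f t).card < κ := fun t => (mem_Pk.1 (hy _)).2
  have hcard : (ZFSet.iUnion f).card < lam := by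
    have := ZFSet.lift_card_iUnion_le_sum_card (f := f)
    rw [Cardinal.lift_id] at this
    refine this.trans_lt ?_
    rcases hp.le.lt_or_eq with h | rfl
    · refine (Cardinal.sum_le_sum _ (fun _ => κ) fun t => (hfc t).le).trans_lt ?_
      rw [Cardinal.sum_const']
      exact Cardinal.mul_lt_of_lt hp.aleph0_le_lam hι h
    · exact Cardinal.sum_lt_of_isRegular hp.isRegular hι hfc
  by_contra! H
  have h1 : lam.ord.toZFSet ⊆ ZFSet.iUnion f := fun z hz => by
    obtain ⟨c, hc, rfl⟩ := Ordinal.mem_toZFSet_iff.1 hz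
    obtain ⟨a, ha, hca⟩ := H c hc
    refine ZFSet.mem_iUnion.2 ⟨Ordinal.ToType.mk ⟨a, Order.lt_succ_of_le ha⟩, ?_⟩
    simpa [f] using hca
  have h2 := (ZFSet.card_mono h1).trans_lt hcard
  simp at h2

/-- The power set of `a` is an element of `N` of size at most `2^{<λ} = λ`, hence a subset of `N`.
-/
theorem IsModel.subset_mem (hN : IsModel κ lam θ N) (hp : Admissible κ lam θ)
    (h2 : (2 : Cardinal.{u}) ^< lam = lam) {a : Ordinal.{u}} (ha : a < lam.ord) {w : ZFSet.{u}}
    (hw : w ⊆ a.toZFSet) : w ∈ N := by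
  have hc : (ZFSet.powerset a.toZFSet).card ≤ lam := by
    rw [ZFSet.card_powerset, Ordinal.card_toZFSet]
    exact (Cardinal.le_powerlt 2 (Cardinal.lt_ord.1 ha)).trans h2.le
  have haN := hN.ord_mem ha.le
  refine hN.subset_of_card_le hp ?_ hc (ZFSet.mem_powerset.2 hw)
  exact hN.elem.mem_of_ext₂ (fun a _ z => z ⊆ a) haN haN
    (FilterGame.mem_H (hc.trans_lt hp.lt) fun z hz => H_subset (hN.mem_H_of_mem haN) (ZFSet.mem_powerset.1 hz))
    fun _ _ => ZFSet.mem_powerset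

open Classical in
theorem IsModel.seq_ite_mem (hN : IsModel κ lam θ N) (hp : Admissible κ lam θ)
    {Z : Ordinal.{u} → ZFSet.{u}} (hZ : seq lam.ord Z ∈ N) {w : ZFSet.{u}} (hw : w ∈ N) :
    seq lam.ord (fun b => if b.toZFSet ∈ w then Z b else Pk κ lam) ∈ N := by
  have hZ' : ∀ j < lam.ord, Z j ∈ H θ := fun j hj =>
    hN.mem_H_of_mem (hN.of_seq_mem hp hZ (by simp) hj).2
  refine hN.elem.mem_of_ext₄ (fun l P z w p => ∃ b ∈ l, ∃ y ∈ H θ, p = ZFSet.pair b y ∧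
      ((b ∈ w ∧ ZFSet.pair b y ∈ z) ∨ (¬ b ∈ w ∧ y = P)))
    (hN.ord_mem le_rfl) (hN.Pk_mem hp le_rfl) hZ hw
    (seq_H hp.aleph0_le_theta (by simpa using hp.lt) fun j hj => ?_) fun p _ => ?_
  · split_ifs
    exacts [hZ' j hj, hp.Pk_H]
  · rw [mem_seq]
    constructor
    · rintro ⟨j, hj, rfl⟩
      refine ⟨_, Ordinal.toZFSet_mem_toZFSet_iff.2 hj, _, ?_, rfl, ?_⟩
      · split_ifs
        exacts [hZ' j hj, hp.Pk_H]
      · split_ifs with h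
        exacts [Or.inl ⟨h, toZFSet_pair_mem_seq.2 ⟨hj, rfl⟩⟩, Or.inr ⟨h, rfl⟩]
    · rintro ⟨b, hb, y, _, rfl, h⟩
      obtain ⟨j, hj, rfl⟩ := Ordinal.mem_toZFSet_iff.1 hb
      refine ⟨j, hj, ?_⟩
      rcases h with ⟨h, hy⟩ | ⟨h, rfl⟩
      · rw [if_pos h, (toZFSet_pair_mem_seq.1 hy).2]
      · rw [if_neg h]

open Classical in
-- Enumerate `N` inside `N'` as `⟨Z b : b < λ⟩`. Although `U` need not be in `N'`, each set `{b < a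
-- : Z b ∈ U}` is, so normality applies to the corresponding part of `U`. Choose `y a` in its
-- diagonal intersection and above the `a`-th finite set, and let `Y` consist of all `y a`. A set `Z
-- b ∈ U` constrains `y a` for every `a > b` with `b ∈ y a`.
theorem exists_pseudoIntersection (hp : Admissible κ lam θ) (h2 : (2 : Cardinal.{u}) ^< lam = lam)
    {N' U : ZFSet.{u}} (hN : IsModel κ lam θ N) (hN' : IsModel κ lam θ N') (hmem : N ∈ N')
    (hU : IsNormalUltrafilter κ lam N' U) :
    ∃ Y, Y ⊆ Pk κ lam ∧ (∀ X ∈ U, X ∈ N → SubsetMod κ lam Y X) ∧ ¬ SubsetMod κ lam Y ∅ := by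
  obtain ⟨Z, hZ, hZN⟩ := hN'.exists_enum hp hmem ⟨_, hN.Pk_mem hp le_rfl⟩ hN.card_eq.le
  obtain ⟨S, hS⟩ := hp.exists_enum_finite
  let w : Ordinal.{u} → ZFSet.{u} := fun a =>
    ZFSet.sep (fun z => ∃ b, z = b.toZFSet ∧ Z b ∈ U) a.toZFSet
  have mem_w : ∀ a b : Ordinal.{u}, b.toZFSet ∈ w a ↔ b < a ∧ Z b ∈ U := fun a b => by
    simp only [w, ZFSet.mem_sep, Ordinal.toZFSet_mem_toZFSet_iff, Ordinal.toZFSet_injective.eq_iff]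
    simp
  let X : Ordinal.{u} → Ordinal.{u} → ZFSet.{u} := fun a b =>
    if b.toZFSet ∈ w a then Z b else Pk κ lam
  have hX : ∀ a < lam.ord, diagInter κ lam (X a) ∈ U := fun a ha => by
    refine hU.normal _ (hN'.seq_ite_mem hp hZ (hN'.subset_mem hp h2 ha ZFSet.sep_subset))
      fun b _ => ?_
    by_cases hb : b.toZFSet ∈ w a
    · simpa [X, hb] using ((mem_w a b).1 hb).2
    · simpa [X, hb] using hU.univ_mem
  have hex : ∀ a : Ordinal.{u}, ∃ x ∈ Pk κ lam, a < lam.ord →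
      x ∈ diagInter κ lam (X a) ∧ S a ⊆ x := fun a => by
    by_cases ha : a < lam.ord
    · obtain ⟨x, hx, h⟩ := hU.finite_cone_mem (hX a ha) ((hS _).2 ⟨a, ha, rfl⟩)
      exact ⟨x, (mem_diagInter.1 hx).1, fun _ => ⟨hx, h⟩⟩
    · exact ⟨∅, mem_Pk.2 ⟨ZFSet.empty_subset _, by
        simpa using hp.aleph0_le.trans_lt' Cardinal.aleph0_pos⟩, fun h => absurd h ha⟩
  choose y hyP hy using hex
  have hYP : ZFSet.range (fun a : Set.Iio lam.ord => y a) ⊆ Pk κ lam := fun x hx => by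
    obtain ⟨a, rfl⟩ := ZFSet.mem_range.1 hx
    exact hyP a
  refine ⟨ZFSet.range (fun a : Set.Iio lam.ord => y a), hYP, fun W hWU hWN => ?_,
    not_subsetMod_empty hYP fun s hs => ?_⟩
  · obtain ⟨b, hb, rfl⟩ := (hZN W).1 hWN
    -- Demanding `c ∈ x` discards the points `y a` with `a ≤ b`, on which `Z b` imposes nothing.
    obtain ⟨c, hc, hcy⟩ := exists_notMem_of_family hp hb y hyP
    refine (subsetMod_iff hYP).2 ⟨_, insert_mem_Pk_aleph0 hb (singleton_mem_Pk_aleph0 hc),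
      fun x hx hsx => ?_⟩
    obtain ⟨⟨a, ha⟩, rfl⟩ := ZFSet.mem_range.1 hx
    have hba : b < a := lt_of_not_ge fun h => hcy a h (hsx (by simp))
    have := (mem_diagInter.1 (hy a ha).1).2 b hb (hsx (by simp))
    simpa [X, (mem_w a b).2 ⟨hba, hWU⟩] using this
  · obtain ⟨a, ha, rfl⟩ := (hS s).1 hs
    exact ⟨y a, ZFSet.mem_range.2 ⟨⟨a, ha⟩, rfl⟩, (hy a ha).2⟩

/-- The diagonal intersection of an enumeration of a family is a pseudo-intersection of it. -/
theorem diagInter_subsetMod {X : Ordinal.{u} → ZFSet.{u}} {a : Ordinal.{u}} (ha : a < lam.ord) :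
    SubsetMod κ lam (diagInter κ lam X) (X a) :=
  ⟨_, finite_mem_fineFilter (singleton_mem_Pk_aleph0 ha), fun _ hx hax =>
    (mem_diagInter.1 hx).2 a ha (hax (ZFSet.mem_singleton.2 rfl))⟩

end

/-! ### Causal recursion -/

section
variable {X S : Type*}

open Classical in
/-- A family of sequences in which the `j`-th value depends only on the inputs up to `j`. -/
theorem exists_causal [Nonempty X] [Nonempty S]
    (P : (Ordinal.{u} → X) → (Ordinal.{u} → S) → Ordinal.{u} → Prop)
    (hP : ∀ x x' s s' j, (∀ k ≤ j, x k = x' k) → (∀ k ≤ j, s k = s' k) → P x s j → P x' s' j)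
    (step : ∀ x s j, (∀ k < j, P x s k) → ∃ v, P x (Function.update s j v) j) :
    ∃ T : (Ordinal.{u} → X) → Ordinal.{u} → S,
      (∀ x x' j, (∀ k ≤ j, x k = x' k) → T x j = T x' j) ∧ ∀ x j, P x (T x) j := by
  obtain ⟨x₀⟩ := ‹Nonempty X›
  obtain ⟨s₀⟩ := ‹Nonempty S›
  -- Inputs after `j` are erased before the choice is made, so the chosen value cannot depend on
  -- them.
  let tx : (Ordinal.{u} → X) → Ordinal.{u} → Ordinal.{u} → X := fun x j k => if k ≤ j then x k else x₀
  let G : (Ordinal.{u} → X) → (Ordinal.{u} → S) → Ordinal.{u} → S := fun x s j =>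
    if h : ∃ v, P x (Function.update s j v) j then h.choose else s₀
  let T : (Ordinal.{u} → X) → Ordinal.{u} → S := fun x => WellFoundedLT.fix fun j prev =>
    G (tx x j) (fun k => if h : k < j then prev k h else s₀) j
  have hT : ∀ x j, T x j = G (tx x j) (fun k => if k < j then T x k else s₀) j := fun x j => by
    have : T x j = G (tx x j) (fun k => if h : k < j then T x k else s₀) j :=
      WellFoundedLT.fix_eq _ j
    simpa using this
  refine ⟨T, fun x x' j => ?_, fun x j => ?_⟩
  · induction j using WellFoundedLT.induction with
    | _ j ih =>
      intro h
      rw [hT, hT]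
      congr 1
      · funext k
        by_cases hk : k ≤ j <;> simp [tx, hk, h]
      · funext k
        by_cases hk : k < j
        · simp only [hk, if_true]
          exact ih k hk fun l hl => h l (hl.trans hk.le)
        · simp [hk]
  · induction j using WellFoundedLT.induction with
    | _ j ih =>
      have h1 : ∀ k < j, P (tx x j) (fun k => if k < j then T x k else s₀) k := fun k hk =>
        hP _ _ _ _ k (fun l hl => by simp [tx, hl.trans hk.le])
          (fun l hl => by simp [hl.trans_lt hk]) (ih k hk)
      have h2 := step _ _ j h1
      have h3 : T x j = h2.choose := by rw [hT]; exact dif_pos h2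
      refine hP _ _ _ _ j (fun l hl => ?_) (fun l hl => ?_) h2.choose_spec
      · simp [tx, hl]
      · rcases hl.eq_or_lt with rfl | hl
        · rw [← h3, Function.update_self]
        · rw [Function.update_of_ne hl.ne]
          simp [hl]

end

section
variable {lam : Cardinal.{u}} {N : Ordinal.{u} → ZFSet.{u}} {γ : Ordinal.{u}}

theorem ChallengerLegal.congr {α α' : Ordinal.{u} → Ordinal.{u}} {m m' : Ordinal.{u} → ZFSet.{u}}
    {i a : Ordinal.{u}} (hα : ∀ j < i, α j = α' j) (hm : ∀ j < i, m j = m' j)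
    (h : ChallengerLegal lam N α m i a) : ChallengerLegal lam N α' m' i a :=
  ⟨h.1, fun j hj => hα j hj ▸ h.2.1 j hj, seq_congr hm ▸ h.2.2⟩

theorem update_of_lt {S : Type*} (s : Ordinal.{u} → S) {j k : Ordinal.{u}} (v : S)
    (h : k < j) : Function.update s j v k = s k :=
  Function.update_of_ne h.ne _ _

theorem IsRun.congr {σ : Strategy.{u}} {α α' : Ordinal.{u} → Ordinal.{u}}
    {m m' : Ordinal.{u} → ZFSet.{u}}
    {ℓ : Ordinal.{u}} (hα : ∀ j < ℓ, α j = α' j) (hm : ∀ j < ℓ, m j = m' j)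
    (h : IsRun lam N σ α m ℓ) : IsRun lam N σ α' m' ℓ := fun i hi => by
  obtain ⟨h1, h2⟩ := h i hi
  refine ⟨hα i hi ▸ h1.congr (fun j hj => hα j (hj.trans hi)) (fun j hj => hm j (hj.trans hi)), ?_⟩
  rw [← hm i hi, h2]
  congr 1
  · funext j
    exact hα j (lt_of_le_of_lt j.2 hi)
  · funext j
    exact hm j (lt_trans j.2 hi)

/-- The strategy `σ`'s answer to the move `a` in round `j`. -/
def answer (σ : Strategy.{u}) (α : Ordinal.{u} → Ordinal.{u}) (m : Ordinal.{u} → ZFSet.{u})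
    (j a : Ordinal.{u}) : ZFSet.{u} :=
  σ j (fun k => Function.update α j a k) (fun k => m k)

theorem answer_congr {σ : Strategy.{u}} {α α' : Ordinal.{u} → Ordinal.{u}}
    {m m' : Ordinal.{u} → ZFSet.{u}} {j a : Ordinal.{u}} (hα : ∀ k < j, α k = α' k)
    (hm : ∀ k < j, m k = m' k) : answer σ α m j a = answer σ α' m' j a := by
  unfold answer
  congr 1
  · funext ⟨k, hk⟩
    rcases (show k ≤ j from hk).eq_or_lt with rfl | hk
    · simp
    · rw [update_of_lt _ _ hk, update_of_lt _ _ hk, hα k hk]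
  · funext k
    exact hm k k.2

theorem isRun_iff {σ : Strategy.{u}} {α : Ordinal.{u} → Ordinal.{u}}
    {m : Ordinal.{u} → ZFSet.{u}} {ℓ : Ordinal.{u}} : IsRun lam N σ α m ℓ ↔
      ∀ i < ℓ, ChallengerLegal lam N α m i (α i) ∧ m i = answer σ α m i (α i) := by
  unfold IsRun answer
  simp

theorem IsRun.extend {σ : Strategy.{u}} {α : Ordinal.{u} → Ordinal.{u}}
    {m : Ordinal.{u} → ZFSet.{u}} {j a : Ordinal.{u}} (h : IsRun lam N σ α m j)
    (ha : ChallengerLegal lam N α m j a) :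
    IsRun lam N σ (Function.update α j a) (Function.update m j (answer σ α m j a)) (j + 1) := by
  rw [isRun_iff]
  intro i hi
  rcases (Order.lt_add_one_iff.1 hi).eq_or_lt with rfl | hi
  · rw [Function.update_self, Function.update_self]
    exact ⟨ha.congr (fun k hk => (update_of_lt _ _ hk).symm)
      (fun k hk => (update_of_lt _ _ hk).symm),
      answer_congr (fun k hk => (update_of_lt _ _ hk).symm)
      (fun k hk => (update_of_lt _ _ hk).symm)⟩
  · exact isRun_iff.1 (h.congr (fun k hk => (update_of_lt _ _ hk).symm)
      (fun k hk => (update_of_lt _ _ hk).symm)) i hi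

/-- A strategy that keeps track of auxiliary states, whose `out` parts are its moves. -/
theorem exists_strategy {S : Type*} [Nonempty S] (out : S → ZFSet.{u})
    (P : (Ordinal.{u} → Ordinal.{u}) → (Ordinal.{u} → S) → Ordinal.{u} → Prop)
    (hP : ∀ x x' s s' j, (∀ k ≤ j, x k = x' k) → (∀ k ≤ j, s k = s' k) → P x s j → P x' s' j)
    (step : ∀ x s j, j < γ → (∀ k ≤ j, ChallengerLegal lam N x (out ∘ s) k (x k)) →
      (∀ k < j, P x s k) → ∃ v, P x (Function.update s j v) j) :
    ∃ τ : Strategy.{u}, ∀ α m ℓ, ℓ ≤ γ → IsRun lam N τ α m ℓ →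
      ∃ s : Ordinal.{u} → S, (∀ i < ℓ, m i = out (s i)) ∧ ∀ i < ℓ, P α s i := by
  classical
  let Q : (Ordinal.{u} → Ordinal.{u}) → (Ordinal.{u} → S) → Ordinal.{u} → Prop := fun x s j =>
    j < γ ∧ ∀ k ≤ j, ChallengerLegal lam N x (out ∘ s) k (x k)
  have hQ : ∀ x x' s s' j, (∀ k ≤ j, x k = x' k) → (∀ k < j, s k = s' k) → Q x s j → Q x' s' j :=
    fun x x' s s' j hx hs h => ⟨h.1, fun k hk => hx k hk ▸ (h.2 k hk).congr
      (fun l hl => hx l (hl.le.trans hk))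
      (fun l hl => congrArg out (hs l (hl.trans_le hk)))⟩
  obtain ⟨T, hTc, hT⟩ := exists_causal (fun x s j => Q x s j → P x s j)
    (fun x x' s s' j hx hs h hq => hP x x' s s' j hx hs (h (hQ _ _ _ _ _
      (fun k hk => (hx k hk).symm) (fun k hk => (hs k hk.le).symm) hq)))
    (fun x s j h => by
      by_cases hq : Q x s j
      · obtain ⟨v, hv⟩ := step x s j hq.1 hq.2 fun k hk => h k hk
          ⟨hk.trans hq.1, fun l hl => hq.2 l (hl.trans hk.le)⟩
        exact ⟨v, fun _ => hv⟩
      · exact ⟨Classical.arbitrary S, fun hq' => absurd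
          (hQ _ _ _ _ _ (fun _ _ => rfl) (fun k hk => update_of_lt _ _ hk) hq') hq⟩)
  -- The Judge's own earlier moves are ignored: the states are recomputed from the Challenger's
  -- moves.
  refine ⟨fun i a _ => out (T (fun k => if h : k ≤ i then a ⟨k, h⟩ else 0) i),
    fun α m ℓ hℓ hrun => ⟨T α, ?_⟩⟩
  have hm : ∀ i < ℓ, m i = out (T α i) := fun i hi => by
    rw [(hrun i hi).2]
    exact congrArg out (hTc _ _ i fun k hk => by simp [hk])
  refine ⟨hm, fun i hi => hT α i ⟨hi.trans_le hℓ, fun k hk => ?_⟩⟩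
  exact (hrun k (hk.trans_lt hi)).1.congr (fun _ _ => rfl) fun l hl => hm l (hl.trans (hk.trans_lt hi))

end

/-! ### The approachable sequence -/

/-- `y` belongs to the union of the models `N b`, `b < λ⁺`. -/
def InUnion (lam : Cardinal.{u}) (N : Ordinal.{u} → ZFSet.{u}) (y : ZFSet.{u}) : Prop :=
  ∃ b < (Order.succ lam).ord, y ∈ N b

section
variable {κ lam θ : Cardinal.{u}} {N : Ordinal.{u} → ZFSet.{u}} {γ : Ordinal.{u}}

theorem Admissible.succ_lt (hp : Admissible κ lam θ) {a : Ordinal.{u}}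
    (ha : a < (Order.succ lam).ord) : a + 1 < (Order.succ lam).ord :=
  (Cardinal.isSuccLimit_ord (hp.aleph0_le_lam.trans (Order.le_succ lam))).add_one_lt ha

theorem Admissible.exists_bound (hp : Admissible κ lam θ) {i : Ordinal.{u}}
    (hi : i < (Order.succ lam).ord) {f : Ordinal.{u} → Ordinal.{u}}
    (hf : ∀ j < i, f j < (Order.succ lam).ord) :
    ∃ b < (Order.succ lam).ord, ∀ j < i, f j < b := by
  let g : i.ToType → Ordinal.{u} := fun t => f (Ordinal.ToType.mk.symm t : Set.Iio i)
  have hg : ⨆ t, g t < (Order.succ lam).ord := by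
    refine Ordinal.iSup_lt_of_lt_cof ?_ fun t => hf _ (Ordinal.ToType.mk.symm t).2
    rw [(Cardinal.isRegular_succ hp.aleph0_le_lam).cof_ord, Cardinal.mk_toType]
    exact Cardinal.lt_ord.1 hi
  refine ⟨(⨆ t, g t) + 1, hp.succ_lt hg, fun j hj => Order.lt_add_one_iff.2 ?_⟩
  simpa [g] using Ordinal.le_iSup g (Ordinal.ToType.mk ⟨j, hj⟩)

theorem card_le_of_lt_succ {a : Ordinal.{u}} (ha : a < (Order.succ lam).ord) : a.card ≤ lam :=
  Order.lt_succ_iff.1 (Cardinal.lt_ord.1 ha)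

theorem card_funs_le {ℓ : Ordinal.{u}} {B : ZFSet.{u}} :
    (ZFSet.funs ℓ.toZFSet B).card ≤ B.card ^ ℓ.card := by
  rw [← Cardinal.lift_le.{u + 1}, ← ZFSet.cardinalMk_coe_sort, Cardinal.lift_power,
    ← ZFSet.cardinalMk_coe_sort, ← Cardinal.mk_Iio_ordinal, Cardinal.power_def]
  have : ∀ g : ZFSet.funs ℓ.toZFSet B, ∃ f : Set.Iio ℓ → B,
      ∀ j : Set.Iio ℓ,
      ZFSet.pair (j : Ordinal.{u}).toZFSet (f j) ∈ (g : ZFSet.{u}) := by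
    rintro ⟨g, hg⟩
    obtain ⟨f, rfl, hf⟩ := exists_eq_seq (ZFSet.mem_funs.1 hg)
    exact ⟨fun j => ⟨f j, hf j j.2⟩, fun j => toZFSet_pair_mem_seq.2 ⟨j.2, rfl⟩⟩
  choose F hF using this
  refine Cardinal.mk_le_of_injective (f := F) fun g g' e => Subtype.ext ?_
  obtain ⟨f, h, _⟩ := exists_eq_seq (ZFSet.mem_funs.1 g.2)
  obtain ⟨f', h', _⟩ := exists_eq_seq (ZFSet.mem_funs.1 g'.2)
  rw [h, h']
  refine seq_congr fun j hj => ?_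
  have h1 := hF g ⟨j, hj⟩
  have h2 := hF g' ⟨j, hj⟩
  rw [h, toZFSet_pair_mem_seq] at h1
  rw [h', toZFSet_pair_mem_seq] at h2
  rw [← h1.2, ← h2.2, e]

namespace IsInternallyApproachable
variable (hN : IsInternallyApproachable κ lam θ N)
include hN

theorem mono {a b : Ordinal.{u}} (hab : a ≤ b) (hb : b < (Order.succ lam).ord) : N a ⊆ N b := by
  rcases hab.eq_or_lt with rfl | hab
  · exact fun _ h => h
  · exact (hN.chain a b hab hb).1

/-- The gap `a + 1 < b` is needed because `N a` is the last entry of the sequence of length `a + 1`,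
which approachability puts into `N b`. -/
theorem mem_model (hp : Admissible κ lam θ) {a b : Ordinal.{u}} (hab : a + 1 < b)
    (hb : b < (Order.succ lam).ord) : a.toZFSet ∈ N b ∧ N a ∈ N b :=
  (hN.model b hb).of_seq_mem hp (hN.approach _ _ hab hb) (card_le_of_lt_succ (hab.trans hb))
    (lt_add_one a)

theorem toZFSet_inUnion (hp : Admissible κ lam θ) {a : Ordinal.{u}}
    (ha : a < (Order.succ lam).ord) : InUnion lam N a.toZFSet :=
  ⟨a + 1 + 1, hp.succ_lt (hp.succ_lt ha),
    (hN.mem_model hp (lt_add_one _) (hp.succ_lt (hp.succ_lt ha))).1⟩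

theorem inUnion_H {y : ZFSet.{u}} (hy : InUnion lam N y) : y ∈ H θ := by
  obtain ⟨b, hb, h⟩ := hy
  exact (hN.model b hb).mem_H_of_mem h

/-- A set of size at most `λ⁺ < θ` that is in the union of the models is a subset of it. -/
theorem inUnion_of_card_le (hp : Admissible κ lam θ) (hlt : Order.succ lam < θ)
    {A y : ZFSet.{u}} (hA : InUnion lam N A) (hc : A.card ≤ Order.succ lam) (hy : y ∈ A) :
    InUnion lam N y := by
  have hAH := hN.inUnion_H hA
  obtain ⟨b, hb, hAb⟩ := hA
  have hM := hN.model b hb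
  have hθ := hp.aleph0_le_theta
  have hΛ : (Order.succ lam).ord.toZFSet ∈ H θ := toZFSet_H (by simpa using hlt)
  obtain ⟨k, hkH, hk⟩ := exists_surjOnto hθ hΛ hAH (by simpa using hc)
  -- The reflected `d` need not be `λ⁺`. Its elements are required to be ordinals of size at most
  -- `λ`, so they are below `λ⁺` and belong to the union of the models.
  obtain ⟨p, hpb, d, hd, k, hk, rfl, h1, h2, h3⟩ := hM.elem.reflect₂
    (fun A l p => ∃ d ∈ H θ, ∃ k ∈ H θ, p = ZFSet.pair d k ∧
      (∀ x ∈ d, (∀ z ∈ x, ∀ w ∈ z, w ∈ x) ∧ (∀ w ∈ x, ∀ z ∈ w, ∀ v ∈ z, v ∈ w)) ∧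
      (∀ x ∈ d, ∃ g ∈ H θ, SurjOnto g l x) ∧ SurjOnto k d A)
    hAb (hM.ord_mem le_rfl) ⟨_, pair_H hθ hΛ hkH, _, hΛ, k, hkH, rfl, by
      intro x hx
      obtain ⟨o, ho, rfl⟩ := Ordinal.mem_toZFSet_iff.1 hx
      have hord := ZFSet.isOrdinal_toZFSet o
      exact ⟨fun z hz w hw => hord.mem_trans hw hz,
        fun w hw z hz v hv => (hord.mem hw).mem_trans hv hz⟩, by
      intro x hx
      refine exists_surjOnto hθ hp.lam_H (H_trans hΛ hx) ?_
      obtain ⟨o, ho, rfl⟩ := Ordinal.mem_toZFSet_iff.1 hx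
      simpa using card_le_of_lt_succ ho, hk⟩
  obtain ⟨ξ, hξ, hξy⟩ := h3.2 y hy
  have hξo : ξ.IsOrdinal := by
    refine ⟨fun z hz w hw => (h1 ξ hξ).1 z hz w hw, fun {u v w} hu hv hw => ?_⟩
    exact (h1 ξ hξ).2 w hw v hv u hu
  obtain ⟨o, rfl⟩ := ZFSet.isOrdinal_iff_mem_range_toZFSet.1 hξo
  obtain ⟨g, -, hg⟩ := h2 _ hξ
  have ho : o < (Order.succ lam).ord := by
    rw [Cardinal.lt_ord, Order.lt_succ_iff]
    simpa using hg.card_le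
  obtain ⟨c, hc, hoc⟩ := hN.toZFSet_inUnion hp ho
  have hmax : max b c < (Order.succ lam).ord := max_lt hb hc
  have hM' := hN.model _ hmax
  have hbm := hN.mono (le_max_left b c) hmax
  -- A model that contains `k`, `A` and the ordinal `ξ` also contains the value of `k` at `ξ`, which
  -- is `y`.
  obtain ⟨z, hz, hzA, hξz⟩ := hM'.elem.reflect₃ (fun a k A z => z ∈ A ∧ ZFSet.pair a z ∈ k)
    (hN.mono (le_max_right b c) hmax hoc) (hbm (hM.pair_mem hpb).2) (hbm hAb)
    ⟨y, H_trans hAH hy, hy, hξy⟩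
  rw [h3.1 _ hξ y hy z hzA hξy hξz]
  exact ⟨_, hmax, hz⟩

/-- By regularity of `λ⁺` all values lie in a single `N b`. The set of functions from `ℓ` to `N b`
is definable from parameters in a later model and has size at most `λ⁺`, so all its elements are in
the union. -/
theorem seq_inUnion_of_power (hp : Admissible κ lam θ) (hlt : Order.succ lam < θ)
    {ℓ : Ordinal.{u}} (hℓ : ℓ < (Order.succ lam).ord) (hpow : lam ^ ℓ.card ≤ Order.succ lam)
    {f : Ordinal.{u} → ZFSet.{u}} (hf : ∀ j < ℓ, InUnion lam N (f j)) :
    InUnion lam N (seq ℓ f) := by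
  have hθ := hp.aleph0_le_theta
  have hex : ∀ j, ∃ b, j < ℓ → b < (Order.succ lam).ord ∧ f j ∈ N b := fun j => by
    by_cases hj : j < ℓ
    · obtain ⟨b, hb⟩ := hf j hj
      exact ⟨b, fun _ => hb⟩
    · exact ⟨0, fun h => absurd h hj⟩
  choose g hg using hex
  obtain ⟨b, hb, hgb⟩ := hp.exists_bound hℓ fun j hj => (hg j hj).1
  have hfb : ∀ j < ℓ, f j ∈ N b := fun j hj => hN.mono (hgb j hj).le hb (hg j hj).2
  obtain ⟨c, hc, hℓc⟩ := hN.toZFSet_inUnion hp hℓ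
  have hb' := hp.succ_lt (hp.succ_lt hb)
  have hmax : max (b + 1 + 1) c < (Order.succ lam).ord := max_lt hb' hc
  have hM := hN.model _ hmax
  have hcard : (ZFSet.funs ℓ.toZFSet (N b)).card ≤ Order.succ lam :=
    card_funs_le.trans ((hN.model b hb).card_eq ▸ hpow)
  have hfun : ZFSet.funs ℓ.toZFSet (N b) ∈ H θ := by
    refine mem_H (hcard.trans_lt hlt) fun y hy => ?_
    obtain ⟨f, rfl, hf⟩ := exists_eq_seq (ZFSet.mem_funs.1 hy)
    exact seq_H hθ ((card_le_of_lt_succ hℓ).trans_lt hp.lt) fun j hj =>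
      (hN.model b hb).mem_H_of_mem (hf j hj)
  refine hN.inUnion_of_card_le hp hlt ⟨_, hmax, ?_⟩ hcard (ZFSet.mem_funs.2 (isFunc_seq hfb))
  exact hM.elem.mem_of_ext₂ (fun l B g => ZFSet.IsFunc l B g) (hN.mono (le_max_right _ _) hmax hℓc)
    (hN.mono (le_max_left _ _) hmax (hN.mem_model hp (lt_add_one _) hb').2) hfun
    fun _ _ => ZFSet.mem_funs

end IsInternallyApproachable

end

/-! ### Closure of the union of the models under sequences -/

section
variable {κ lam θ : Cardinal.{u}} {N : Ordinal.{u} → ZFSet.{u}} {γ : Ordinal.{u}}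
  {J : (Ordinal.{u} → Ordinal.{u}) → (Ordinal.{u} → ZFSet.{u}) → Ordinal.{u} → Prop}
  {σ : Strategy.{u}}

/-- Every set in the union of the models is a legal answer only to boundedly many moves. -/
def BoundedFibers (lam : Cardinal.{u}) (N : Ordinal.{u} → ZFSet.{u})
    (J : (Ordinal.{u} → Ordinal.{u}) → (Ordinal.{u} → ZFSet.{u}) → Ordinal.{u} → Prop) : Prop :=
  ∀ y, InUnion lam N y → ∃ β < (Order.succ lam).ord,
    ∀ α m i, J α m i → m i = y → α i < (Order.succ lam).ord → α i ≤ β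

theorem ChallengerLegal.mono (hN : IsInternallyApproachable κ lam θ N) (hp : Admissible κ lam θ)
    {α : Ordinal.{u} → Ordinal.{u}} {m : Ordinal.{u} → ZFSet.{u}} {i a b : Ordinal.{u}}
    (h : ChallengerLegal lam N α m i a) (hab : a ≤ b) (hb : b < (Order.succ lam).ord) :
    ChallengerLegal lam N α m i b :=
  ⟨hb, fun j hj => (h.2.1 j hj).trans_le hab, hN.mono (by simpa using hab) (hp.succ_lt hb) h.2.2⟩

theorem ChallengerLegal.inUnion (hN : IsInternallyApproachable κ lam θ N)
    (hp : Admissible κ lam θ) {α : Ordinal.{u} → Ordinal.{u}} {m : Ordinal.{u} → ZFSet.{u}}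
    {i a j : Ordinal.{u}} (h : ChallengerLegal lam N α m i a) (hi : i < (Order.succ lam).ord)
    (hj : j < i) : m j ∈ N (a + 1) :=
  ((hN.model _ (hp.succ_lt h.1)).of_seq_mem hp h.2.2 (card_le_of_lt_succ hi) hj).2

theorem IsWinning.inUnion (hwin : IsWinning lam N γ J σ) (hN : IsInternallyApproachable κ lam θ N)
    (hp : Admissible κ lam θ) (hγ : γ ≤ (Order.succ lam).ord)
    {α : Ordinal.{u} → Ordinal.{u}} {m : Ordinal.{u} → ZFSet.{u}} {ℓ i : Ordinal.{u}}
    (hrun : IsRun lam N σ α m ℓ) (hℓ : ℓ < γ) (hi : i < ℓ) : InUnion lam N (m i) := by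
  obtain ⟨a, ha⟩ := (hwin α m ℓ hℓ.le hrun).2 hℓ
  exact ⟨_, hp.succ_lt ha.1, ha.inUnion hN hp (hℓ.trans_le hγ) hi⟩

/-- Legal moves are closed upwards below `λ⁺`, so one can recursively move beyond the bounds
attached to all earlier answers. A further round (`j + 1 < γ`) is needed to know that these answers
lie in the union, where `BoundedFibers` applies. -/
theorem IsWinning.exists_branching (hwin : IsWinning lam N γ J σ)
    (hN : IsInternallyApproachable κ lam θ N) (hp : Admissible κ lam θ)
    (hγ : γ ≤ (Order.succ lam).ord) (hJ : BoundedFibers lam N J)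
    {α : Ordinal.{u} → Ordinal.{u}} {m : Ordinal.{u} → ZFSet.{u}} {j : Ordinal.{u}}
    (hrun : IsRun lam N σ α m j) (hj : j + 1 < γ) :
    ∃ g : Ordinal.{u} → Ordinal.{u}, ∀ ξ < (Order.succ lam).ord,
      ChallengerLegal lam N α m j (g ξ) ∧ ∀ η < ξ, answer σ α m j (g η) ≠ answer σ α m j (g ξ) := by
  have hj' : j < γ := (lt_add_one j).trans hj
  have key : ∀ a, ∃ β, ChallengerLegal lam N α m j a → β < (Order.succ lam).ord ∧
      ∀ c, ChallengerLegal lam N α m j c → answer σ α m j a = answer σ α m j c → c ≤ β := by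
    intro a
    by_cases ha : ChallengerLegal lam N α m j a
    · have hU := hwin.inUnion hN hp hγ (hrun.extend ha) hj (lt_add_one j)
      rw [Function.update_self] at hU
      obtain ⟨β, hβ, h⟩ := hJ _ hU
      refine ⟨β, fun _ => ⟨hβ, fun c hc hac => ?_⟩⟩
      have := h _ _ j ((hwin _ _ _ hj.le (hrun.extend hc)).1 j (lt_add_one j))
      simp only [Function.update_self] at this
      exact this hac.symm hc.1
    · exact ⟨0, fun h => absurd h ha⟩
  choose β hβ using key
  obtain ⟨a₀, ha₀⟩ := (hwin α m j hj'.le hrun).2 hj'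
  obtain ⟨T, -, hT⟩ := exists_causal (X := Unit) (S := Ordinal.{u})
    (fun _ s ξ => ξ < (Order.succ lam).ord →
      ChallengerLegal lam N α m j (s ξ) ∧ ∀ η < ξ, β (s η) < s ξ)
    (fun _ _ s s' ξ _ hs h hξ => by
      rw [← hs ξ le_rfl]
      exact ⟨(h hξ).1, fun η hη => hs η hη.le ▸ (h hξ).2 η hη⟩)
    (fun _ s ξ ih => by
      by_cases hξ : ξ < (Order.succ lam).ord
      · obtain ⟨b, hb, hsb⟩ := hp.exists_bound hξ fun η hη =>
          (hβ (s η) (ih η hη (hη.trans hξ)).1).1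
        refine ⟨max a₀ b, fun _ => ?_⟩
        rw [Function.update_self]
        refine ⟨ha₀.mono hN hp (le_max_left _ _) (max_lt ha₀.1 hb), fun η hη => ?_⟩
        rw [update_of_lt _ _ hη]
        exact (hsb η hη).trans_le (le_max_right _ _)
      · exact ⟨0, fun h => absurd h hξ⟩)
  refine ⟨T fun _ => (), fun ξ hξ => ⟨(hT _ ξ hξ).1, fun η hη e => ?_⟩⟩
  exact ((hT _ ξ hξ).2 η hη).not_ge
    ((hβ _ (hT _ η (hη.trans hξ)).1).2 _ (hT _ ξ hξ).1 e)

/-- A tree of runs, one for every sequence of ordinals less than `λ⁺`. -/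
theorem IsWinning.exists_tree (hwin : IsWinning lam N γ J σ)
    (hN : IsInternallyApproachable κ lam θ N) (hp : Admissible κ lam θ)
    (hγ : γ ≤ (Order.succ lam).ord) (hJ : BoundedFibers lam N J) {ℓ : Ordinal.{u}} (hℓ : ℓ < γ) :
    ∃ m : (Ordinal.{u} → Ordinal.{u}) → Ordinal.{u} → ZFSet.{u},
      (∀ x, (∀ k < ℓ, x k < (Order.succ lam).ord) → InUnion lam N (seq ℓ (m x))) ∧
      ∀ x x', (∀ k < ℓ, x k < (Order.succ lam).ord) → (∀ k < ℓ, x' k < (Order.succ lam).ord) →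
        seq ℓ (m x) = seq ℓ (m x') → ∀ k < ℓ, x k = x' k := by
  classical
  have hex : ∀ (α : Ordinal.{u} → Ordinal.{u}) (m : Ordinal.{u} → ZFSet.{u}) (j : Ordinal.{u}),
      ∃ g : Ordinal.{u} → Ordinal.{u}, j < ℓ → IsRun lam N σ α m j → ∀ ξ < (Order.succ lam).ord,
        ChallengerLegal lam N α m j (g ξ) ∧
          ∀ η < ξ, answer σ α m j (g η) ≠ answer σ α m j (g ξ) := fun α m j => by
    by_cases h : j < ℓ ∧ IsRun lam N σ α m j
    · obtain ⟨g, hg⟩ := hwin.exists_branching hN hp hγ hJ h.2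
        ((Order.add_one_le_iff.2 h.1).trans_lt hℓ)
      exact ⟨g, fun _ _ => hg⟩
    · exact ⟨id, fun h1 h2 => absurd ⟨h1, h2⟩ h⟩
  choose G hG using hex
  -- Truncation makes the moves chosen at a node depend only on the history below it, so branches
  -- that agree so far choose from the same family.
  let tr : (Ordinal.{u} → Ordinal.{u} × ZFSet.{u}) → Ordinal.{u} →
    Ordinal.{u} → Ordinal.{u} × ZFSet.{u} := fun s j k => if k < j then s k else (0, ∅)
  have htr : ∀ s j k, k < j → tr s j k = s k := fun s j k hk => if_pos hk
  have htr' : ∀ s s' j, (∀ k < j, s k = s' k) → tr s j = tr s' j := fun s s' j h => by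
    funext k
    by_cases hk : k < j <;> simp [tr, hk, h]
  let mv : (Ordinal.{u} → Ordinal.{u} × ZFSet.{u}) → Ordinal.{u} → Ordinal.{u} → Ordinal.{u} :=
    fun s j ξ => G (fun k => (tr s j k).1) (fun k => (tr s j k).2) j ξ
  have hmv : ∀ s s' j, (∀ k < j, s k = s' k) → mv s j = mv s' j := fun s s' j h => by
    simp only [mv, htr' s s' j h]
  let val : (Ordinal.{u} → Ordinal.{u} × ZFSet.{u}) → Ordinal.{u} → Ordinal.{u} →
    Ordinal.{u} × ZFSet.{u} := fun s j ξ =>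
      (mv s j ξ, answer σ (fun k => (s k).1) (fun k => (s k).2) j (mv s j ξ))
  have hval : ∀ s s' j, (∀ k < j, s k = s' k) → val s j = val s' j := fun s s' j h => by
    funext ξ
    simp only [val, hmv s s' j h]
    exact congrArg _ (answer_congr (fun k hk => by rw [h k hk]) fun k hk => by rw [h k hk])
  obtain ⟨T, hTc, hT⟩ := exists_causal (X := Ordinal.{u}) (S := Ordinal.{u} × ZFSet.{u})
    (fun x s j => s j = val s j (x j))
    (fun x x' s s' j hx hs h => by
      rw [← hs j le_rfl, ← hx j le_rfl, ← hval s s' j fun k hk => hs k hk.le, h])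
    (fun x s j _ => ⟨val s j (x j), by
      rw [Function.update_self]
      exact (congrFun (hval _ _ j fun k hk => update_of_lt _ _ hk) _).symm⟩)
  have hnode : ∀ x j, j < ℓ → IsRun lam N σ (fun k => (T x k).1) (fun k => (T x k).2) j →
      ∀ ξ < (Order.succ lam).ord,
        ChallengerLegal lam N (fun k => (T x k).1) (fun k => (T x k).2) j (mv (T x) j ξ) ∧
        ∀ η < ξ, (val (T x) j η).2 ≠ (val (T x) j ξ).2 := by
    intro x j hj hrun ξ hξ
    have e1 : ∀ k < j, (T x k).1 = (tr (T x) j k).1 := fun k hk => by rw [htr _ _ _ hk]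
    have e2 : ∀ k < j, (T x k).2 = (tr (T x) j k).2 := fun k hk => by rw [htr _ _ _ hk]
    have := hG (fun k => (tr (T x) j k).1) (fun k => (tr (T x) j k).2) j hj (hrun.congr e1 e2) ξ hξ
    refine ⟨this.1.congr (fun k hk => (e1 k hk).symm) (fun k hk => (e2 k hk).symm),
      fun η hη => ?_⟩
    have h := this.2 η hη
    rwa [← answer_congr e1 e2, ← answer_congr e1 e2] at h
  have hrun : ∀ x, (∀ k < ℓ, x k < (Order.succ lam).ord) → ∀ j ≤ ℓ,
      IsRun lam N σ (fun k => (T x k).1) (fun k => (T x k).2) j := by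
    intro x hx j
    induction j using WellFoundedLT.induction with
    | _ j ih =>
      intro hj
      rw [isRun_iff]
      intro i hi
      have hiℓ := hi.trans_le hj
      have h1 := (hnode x i hiℓ (ih i hi hiℓ.le) _ (hx i hiℓ)).1
      have h2 := hT x i
      refine ⟨?_, ?_⟩
      · rw [h2]
        exact h1
      · conv_lhs => rw [h2]
        conv_rhs => rw [h2]
  refine ⟨fun x k => (T x k).2, fun x hx => ?_, fun x x' hx hx' he => ?_⟩
  -- As `ℓ < γ`, the Challenger can continue, and the rule for that move puts the whole sequence of
  -- answers into a model.
  · obtain ⟨a, ha⟩ := (hwin _ _ ℓ hℓ.le (hrun x hx ℓ le_rfl)).2 hℓ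
    exact ⟨_, hp.succ_lt ha.1, ha.2.2⟩
  · intro k
    induction k using WellFoundedLT.induction with
    | _ k ih =>
      intro hk
      have hs : ∀ l < k, T x l = T x' l := fun l hl =>
        hTc x x' l fun i hi => ih i (hi.trans_lt hl) ((hi.trans_lt hl).trans hk)
      have h3 : (val (T x) k (x k)).2 = (val (T x) k (x' k)).2 := by
        rw [← hT x k, hval _ _ k hs, ← hT x' k]
        exact seq_inj he k hk
      have hn := hnode x k hk (hrun x hx k hk.le)
      rcases lt_trichotomy (x k) (x' k) with h | h | h
      · exact absurd h3 ((hn _ (hx' k hk)).2 _ h)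
      · exact h
      · exact absurd h3.symm ((hn _ (hx k hk)).2 _ h)

/-- The tree injects `(λ⁺)^|ℓ|` sequences into the union of `λ⁺` models of size `λ`. -/
theorem IsWinning.power_le (hwin : IsWinning lam N γ J σ)
    (hN : IsInternallyApproachable κ lam θ N) (hp : Admissible κ lam θ)
    (hγ : γ ≤ (Order.succ lam).ord) (hJ : BoundedFibers lam N J) {ℓ : Ordinal.{u}} (hℓ : ℓ < γ) :
    lam ^ ℓ.card ≤ Order.succ lam := by
  classical
  obtain ⟨m, hm, hinj⟩ := hwin.exists_tree hN hp hγ hJ hℓ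
  let Λ := (Order.succ lam).ord
  let W : ZFSet.{u} := ZFSet.iUnion fun t : Λ.ToType => N (Ordinal.ToType.mk.symm t : Set.Iio Λ)
  have hW : ∀ y, InUnion lam N y → y ∈ W := fun y ⟨b, hb, hy⟩ =>
    ZFSet.mem_iUnion.2 ⟨Ordinal.ToType.mk ⟨b, hb⟩, by simpa using hy⟩
  have hΛ : ℵ₀ ≤ Order.succ lam := hp.aleph0_le_lam.trans (Order.le_succ lam)
  have hWc : W.card ≤ Order.succ lam := by
    have := ZFSet.lift_card_iUnion_le_sum_card
      (f := fun t : Λ.ToType => N (Ordinal.ToType.mk.symm t : Set.Iio Λ))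
    rw [Cardinal.lift_id] at this
    refine this.trans ((Cardinal.sum_le_sum _ (fun _ => lam) fun t =>
      (hN.model _ (Ordinal.ToType.mk.symm t).2).card_eq.le).trans ?_)
    rw [Cardinal.sum_const', Cardinal.mk_toType, card_ord]
    exact Cardinal.mul_le_of_le hΛ le_rfl (Order.le_succ lam)
  let ext : (Set.Iio ℓ → Set.Iio Λ) → Ordinal.{u} → Ordinal.{u} := fun x k =>
    if h : k < ℓ then x ⟨k, h⟩ else 0
  have hext : ∀ x, ∀ k < ℓ, ext x k < Λ := fun x k hk => by
    simp only [ext, hk, dif_pos]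
    exact (x ⟨k, hk⟩).2
  have hle : #(Set.Iio ℓ → Set.Iio Λ) ≤ #W := by
    refine Cardinal.mk_le_of_injective
      (f := fun x => (⟨seq ℓ (m (ext x)), hW _ (hm _ (hext x))⟩ : W)) fun x x' h => ?_
    have := hinj _ _ (hext x) (hext x') (congrArg Subtype.val h)
    funext ⟨k, hk⟩
    have hk' : k < ℓ := hk
    have := this k hk'
    simp only [ext, hk', dif_pos] at this
    exact Subtype.ext this
  rw [← Cardinal.power_def, Cardinal.mk_Iio_ordinal, Cardinal.mk_Iio_ordinal,
    ZFSet.cardinalMk_coe_sort, ← Cardinal.lift_power, Cardinal.lift_le, card_ord] at hle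
  exact ((Cardinal.power_le_power_right (Order.le_succ lam)).trans hle).trans hWc

theorem IsWinning.seq_inUnion (hwin : IsWinning lam N γ J σ)
    (hN : IsInternallyApproachable κ lam θ N) (hp : Admissible κ lam θ)
    (hγ : γ ≤ (Order.succ lam).ord) (hJ : BoundedFibers lam N J)
    (hlarge : Order.succ lam < θ ∨ ∀ x ∈ H θ, ∃ i < (Order.succ lam).ord, x ∈ N i)
    {ℓ : Ordinal.{u}} (hℓ : ℓ < γ) {f : Ordinal.{u} → ZFSet.{u}}
    (hf : ∀ j < ℓ, InUnion lam N (f j)) : InUnion lam N (seq ℓ f) := by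
  rcases hlarge with hlt | hall
  · exact hN.seq_inUnion_of_power hp hlt (hℓ.trans_le hγ) (hwin.power_le hN hp hγ hJ hℓ) hf
  · exact hall _ (seq_H hp.aleph0_le_theta
      ((card_le_of_lt_succ (hℓ.trans_le hγ)).trans_lt hp.lt) fun j hj => hN.inUnion_H (hf j hj))

/-- The Challenger can move whenever the Judge's previous moves are in the union of the models. -/
theorem exists_challengerLegal (hN : IsInternallyApproachable κ lam θ N) (hp : Admissible κ lam θ)
    {α : Ordinal.{u} → Ordinal.{u}} {m : Ordinal.{u} → ZFSet.{u}} {ℓ : Ordinal.{u}}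
    (hℓ : ℓ < (Order.succ lam).ord) (hα : ∀ j < ℓ, α j < (Order.succ lam).ord)
    (h : InUnion lam N (seq ℓ m)) : ∃ a, ChallengerLegal lam N α m ℓ a := by
  obtain ⟨b, hb, hm⟩ := h
  obtain ⟨c, hc, hαc⟩ := hp.exists_bound hℓ hα
  have hmax := max_lt hb hc
  exact ⟨max b c, hmax, fun j hj => (hαc j hj).trans_le (le_max_right _ _),
    hN.mono ((le_max_left b c).trans le_self_add) (hp.succ_lt hmax) hm⟩

end

/-! ### The two games -/

section
variable {κ lam θ : Cardinal.{u}} {N : Ordinal.{u} → ZFSet.{u}} {γ : Ordinal.{u}}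
  {σ : Strategy.{u}}

theorem Admissible.lam_le_card_Pk (hp : Admissible κ lam θ) : lam ≤ (Pk κ lam).card := by
  have : lam.ord.toZFSet.card ≤ (Pk κ lam).card := by
    refine card_le_iff_exists_injective.2 ⟨fun y => ⟨{(y : ZFSet.{u})}, mem_Pk.2 ⟨fun z hz => ?_, ?_⟩⟩,
      fun y z h => ?_⟩
    · rw [ZFSet.mem_singleton.1 hz]
      exact y.2
    · simpa using one_lt_aleph0.trans_le hp.aleph0_le
    · exact Subtype.ext (ZFSet.singleton_injective (congrArg Subtype.val h))
  simpa using this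

/-- A model that has another model as an element has a new subset of `P_κ(λ)`. -/
theorem IsModel.exists_new_subset (hp : Admissible κ lam θ) {M M' : ZFSet.{u}}
    (hM : IsModel κ lam θ M) (hM' : IsModel κ lam θ M') (hmem : M ∈ M') :
    ∃ X ∈ M', X ⊆ Pk κ lam ∧ X ∉ M := by
  refine hM'.elem.reflect₂ (fun P M X => X ⊆ P ∧ ¬ X ∈ M) (hM'.Pk_mem hp le_rfl) hmem ?_
  by_contra! H
  have h1 : ZFSet.powerset (Pk κ lam) ⊆ M := fun X hX =>
    H X (H_subset hp.Pk_H (ZFSet.mem_powerset.1 hX)) (ZFSet.mem_powerset.1 hX)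
  have h2 := (ZFSet.card_mono h1).trans_eq hM.card_eq
  rw [ZFSet.card_powerset] at h2
  exact ((Cardinal.cantor _).trans_le h2).not_ge hp.lam_le_card_Pk

/-- An ultrafilter on a model determines, via its members and their complements, which subsets of
`P_κ(λ)` the model has; a sufficiently later model has new ones. -/
theorem boundedFibers₁ (hN : IsInternallyApproachable κ lam θ N) (hp : Admissible κ lam θ) :
    BoundedFibers lam N (JudgeLegal₁ κ lam N) := by
  intro U _
  by_cases h : ∃ a < (Order.succ lam).ord, IsNormalUltrafilter κ lam (N (a + 1)) U
  · obtain ⟨a, ha, hU⟩ := h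
    refine ⟨a + 1, hp.succ_lt ha, ?_⟩
    rintro α m i ⟨hU', -⟩ rfl hi
    by_contra! hlt
    have hi' := hp.succ_lt hi
    obtain ⟨X, hX, hXP, hXN⟩ := IsModel.exists_new_subset hp (hN.model _ (hp.succ_lt ha))
      (hN.model _ hi') (hN.mem_model hp (by simpa using hlt) hi').2
    rcases hU'.measures X hX hXP with h | h
    · exact hXN (hU.subset _ h).1
    · have hM := hN.model _ (hp.succ_lt ha)
      have := hM.sdiff_mem (hM.Pk_mem hp le_rfl) (hU.subset _ h).1
      refine hXN ?_
      convert this using 1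
      ext z
      simp only [ZFSet.mem_sdiff]
      exact ⟨fun hz => ⟨hXP hz, fun h => h.2 hz⟩, fun hz => by
        by_contra hzX
        exact hz.2 ⟨hz.1, hzX⟩⟩
  · push Not at h
    exact ⟨0, (Cardinal.isSuccLimit_ord (hp.aleph0_le_lam.trans (Order.le_succ lam))).bot_lt,
      fun α m i hJ he hi => absurd (he ▸ hJ.1) (h _ hi)⟩

/-- If `Y ∈ N b`, then `Y` lies in all later models and cannot generate a normal ultrafilter on any
of them. -/
theorem boundedFibers₂ (hN : IsInternallyApproachable κ lam θ N) (hp : Admissible κ lam θ) :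
    BoundedFibers lam N (JudgeLegal₂ κ lam N) := by
  rintro Y ⟨b, hb, hY⟩
  refine ⟨b, hb, ?_⟩
  rintro α m i ⟨hYP, -, hU⟩ rfl hi
  by_contra! hlt
  have hi' := hp.succ_lt hi
  exact (hN.model _ hi').not_normal_generated hp
    (hN.mono (hlt.le.trans le_self_add) hi' hY) hYP hU

/-- The state of a simulated play of a game in another one. -/
structure PlayState : Type (u + 1) where
  move : Ordinal.{u}
  ultra : ZFSet.{u}
  set : ZFSet.{u}
  bound : Ordinal.{u}

instance : Nonempty PlayState.{u} := ⟨⟨0, ∅, ∅, 0⟩⟩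

theorem judgeWins₁_of_judgeWins₂ (hN : IsInternallyApproachable κ lam θ N)
    (hp : Admissible κ lam θ)
    (hlarge : Order.succ lam < θ ∨ ∀ x ∈ H θ, ∃ i < (Order.succ lam).ord, x ∈ N i)
    (hγ : γ ≤ (Order.succ lam).ord) (h : JudgeWins₂ κ lam N γ) : JudgeWins₁ κ lam N γ := by
  obtain ⟨σ, hσ⟩ := h
  obtain ⟨τ, hτ⟩ := exists_strategy (lam := lam) (N := N) (γ := γ) PlayState.ultra
    (fun x s j => x j ≤ (s j).move ∧
      ChallengerLegal lam N (fun k => (s k).move) (fun k => (s k).set) j (s j).move ∧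
      (s j).set = answer σ (fun k => (s k).move) (fun k => (s k).set) j (s j).move ∧
      (s j).ultra = generated κ lam (N (x j + 1)) (s j).set)
    (fun x x' s s' j hx hs ⟨h1, h2, h3, h4⟩ => by
      rw [← hs j le_rfl, ← hx j le_rfl]
      have e1 : ∀ k < j, (s k).move = (s' k).move := fun k hk => by rw [hs k hk.le]
      have e2 : ∀ k < j, (s k).set = (s' k).set := fun k hk => by rw [hs k hk.le]
      exact ⟨h1, h2.congr e1 e2, answer_congr e1 e2 ▸ h3, h4⟩)
    (fun x s j hj hx ih => by
      have hrun : IsRun lam N σ (fun k => (s k).move) (fun k => (s k).set) j :=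
        isRun_iff.2 fun k hk => ⟨(ih k hk).2.1, (ih k hk).2.2.1⟩
      obtain ⟨b, hb⟩ := (hσ _ _ j hj.le hrun).2 hj
      -- The Challenger's ordinal need not be legal in the simulated game, as `N (x j + 1)` may miss
      -- the sequence of sets; it is raised above a legal move `b`.
      let a := max (x j) b
      have ha : ChallengerLegal lam N (fun k => (s k).move) (fun k => (s k).set) j a :=
        hb.mono hN hp (le_max_right _ _) (max_lt (hx j le_rfl).1 hb.1)
      let Y := answer σ (fun k => (s k).move) (fun k => (s k).set) j a
      refine ⟨⟨a, generated κ lam (N (x j + 1)) Y, Y, 0⟩, ?_⟩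
      simp only [Function.update_self]
      refine ⟨le_max_left _ _, ha.congr ?_ ?_, answer_congr ?_ ?_, trivial⟩ <;>
      · intro k hk
        rw [update_of_lt _ _ hk])
  refine ⟨τ, fun α m ℓ hℓ hrun => ?_⟩
  obtain ⟨s, hm, hs⟩ := hτ α m ℓ hℓ hrun
  have hrun' : IsRun lam N σ (fun k => (s k).move) (fun k => (s k).set) ℓ :=
    isRun_iff.2 fun k hk => ⟨(hs k hk).2.1, (hs k hk).2.2.1⟩
  have hJ := (hσ _ _ ℓ hℓ hrun').1
  have hα : ∀ i < ℓ, α i + 1 < (Order.succ lam).ord := fun i hi => hp.succ_lt (hrun i hi).1.1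
  refine ⟨fun i hi => ⟨?_, fun j hj => ?_⟩, fun hlt => ?_⟩
  · have hsub : N (α i + 1) ⊆ N ((s i).move + 1) :=
      hN.mono (by simpa using (hs i hi).1) (hp.succ_lt (hs i hi).2.1.1)
    have := (hJ i hi).2.2.inter hp (hN.model _ (hα i hi)) hsub
    rw [hm i hi, (hs i hi).2.2.2]
    convert this using 1
    ext X
    simp only [ZFSet.mem_inter, mem_generated]
    exact ⟨fun h => ⟨⟨hsub h.1, h.2⟩, h.1⟩, fun h => ⟨h.2, h.1.2⟩⟩
  · rw [hm i hi, hm j (hj.trans hi), (hs i hi).2.2.2, (hs j (hj.trans hi)).2.2.2]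
    intro X hX
    obtain ⟨h1, h2, h3⟩ := mem_generated.1 hX
    have hlt : α j + 1 ≤ α i + 1 := by simpa using ((hrun i hi).1.2.1 j hj).le
    exact mem_generated.2 ⟨hN.mono hlt (hα i hi) h1, h2, ((hJ i hi).2.1 j hj).trans h3⟩
  -- Each translated ultrafilter is definable from `N (α j + 1)` and the set that generates it, so
  -- it lies in the union; `seq_inUnion` then handles the whole sequence.
  · refine exists_challengerLegal hN hp (hlt.trans_le hγ) (fun j hj => (hrun j hj).1.1)
      (hσ.seq_inUnion hN hp hγ (boundedFibers₂ hN hp) hlarge hlt fun j hj => ?_)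
    obtain ⟨b, hb, hY⟩ := hσ.inUnion hN hp hγ hrun' hlt hj
    have hα' := hp.succ_lt (hp.succ_lt (hα j hj))
    have hmax := max_lt hb hα'
    rw [hm j hj, (hs j hj).2.2.2]
    exact ⟨_, hmax, (hN.model _ hmax).generated_mem hp
      (hN.mono (le_max_right _ _) hmax (hN.mem_model hp (lt_add_one _) hα').2)
      (hN.mono (le_max_left _ _) hmax hY) (hJ j hj).1⟩

/-- A set that generates the Judge's ultrafilter on a smaller model; it belongs to all later
ultrafilters if there is a next round. -/
theorem exists_generator (hN : IsInternallyApproachable κ lam θ N) (hp : Admissible κ lam θ)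
    (hγ : γ ≤ (Order.succ lam).ord)
    (hcase : Order.IsSuccPrelimit γ ∨ (2 : Cardinal.{u}) ^< lam = lam)
    (hσ : IsWinning lam N γ (JudgeLegal₁ κ lam N) σ)
    {α : Ordinal.{u} → Ordinal.{u}} {m : Ordinal.{u} → ZFSet.{u}} {j c : Ordinal.{u}} (hj : j < γ)
    (hrun : IsRun lam N σ α m (j + 1)) (hc : c + 1 < α j + 1) :
    ∃ Y, ∃ w < (Order.succ lam).ord, Y ⊆ Pk κ lam ∧
      (∀ X ∈ m j, X ∈ N c → SubsetMod κ lam Y X) ∧ ¬ SubsetMod κ lam Y ∅ ∧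
      (j + 1 < γ → InUnion lam N Y ∧ ∀ U b, w ≤ b → b < (Order.succ lam).ord → m j ⊆ U →
        IsNormalUltrafilter κ lam (N (b + 1)) U → Y ∈ U) := by
  have hα : α j < (Order.succ lam).ord := (hrun j (lt_add_one j)).1.1
  have hU := ((hσ _ _ _ (Order.add_one_le_iff.2 hj) hrun).1 j (lt_add_one j)).1
  by_cases hj' : j + 1 < γ
  · obtain ⟨b, hb⟩ := (hσ _ _ _ hj'.le hrun).2 hj'
    have hM := hN.model _ (hp.succ_lt hb.1)
    have hmb : m j ∈ N (b + 1) := hb.inUnion hN hp (hj'.trans_le hγ) (lt_add_one j)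
    obtain ⟨X, hX, hXm⟩ := hM.exists_enum hp hmb ⟨_, hU.univ_mem⟩
      (hU.card_le (hN.model _ (hp.succ_lt hα)))
    have hYU : ∀ U b', b ≤ b' → b' < (Order.succ lam).ord → m j ⊆ U →
        IsNormalUltrafilter κ lam (N (b' + 1)) U → diagInter κ lam X ∈ U :=
      fun U b' hbb hb' hmU hU' => hU'.normal X (hN.mono (by simpa using hbb) (hp.succ_lt hb') hX)
        fun a ha => hmU ((hXm _).2 ⟨a, ha, rfl⟩)
    have hYP : diagInter κ lam X ⊆ Pk κ lam := fun _ hx => (mem_diagInter.1 hx).1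
    refine ⟨diagInter κ lam X, b, hb.1, hYP, fun Z hZ _ => ?_, ?_,
      fun _ => ⟨⟨_, hp.succ_lt hb.1, hM.diagInter_mem hp hX⟩, hYU⟩⟩
    · obtain ⟨a, ha, rfl⟩ := (hXm Z).1 hZ
      exact diagInter_subsetMod ha
    -- One more simulated round gives an ultrafilter that contains the diagonal intersection, which
    -- is therefore nonempty modulo the fine filter.
    · have hJ := (hσ _ _ _ (Order.add_one_le_iff.2 hj') (hrun.extend hb)).1 (j + 1) (lt_add_one _)
      obtain ⟨hU', hsub⟩ := hJ
      rw [Function.update_self] at hU' hsub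
      rw [Function.update_self] at hU'
      have hsub := hsub j (lt_add_one j)
      rw [update_of_lt _ _ (lt_add_one j)] at hsub
      exact not_subsetMod_empty hYP fun s hs =>
        hU'.finite_cone_mem (hYU _ b le_rfl hb.1 hsub hU') hs
  -- Round `j` is the last one, so `γ = j + 1` is a successor and the cardinal arithmetic hypothesis
  -- is available.
  · have h2 : (2 : Cardinal.{u}) ^< lam = lam := hcase.resolve_left fun h => hj' (by
      rcases (Order.add_one_le_iff.2 hj).lt_or_eq with h' | h'
      · exact h'
      · exact absurd h (by rw [← h']; exact Order.not_isSuccPrelimit_add_one j))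
    have hα' := hp.succ_lt hα
    obtain ⟨Y, hYP, hY, hY'⟩ := exists_pseudoIntersection hp h2
      (hN.model c ((lt_add_one c).trans (hc.trans hα'))) (hN.model _ hα')
      (hN.mem_model hp hc hα').2 hU
    exact ⟨Y, 0, (Cardinal.isSuccLimit_ord (hp.aleph0_le_lam.trans (Order.le_succ lam))).bot_lt,
      hYP, hY, hY', fun h => absurd h hj'⟩

theorem judgeWins₂_of_judgeWins₁ (hN : IsInternallyApproachable κ lam θ N)
    (hp : Admissible κ lam θ)
    (hlarge : Order.succ lam < θ ∨ ∀ x ∈ H θ, ∃ i < (Order.succ lam).ord, x ∈ N i)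
    (hγ : γ ≤ (Order.succ lam).ord)
    (hcase : Order.IsSuccPrelimit γ ∨ (2 : Cardinal.{u}) ^< lam = lam)
    (h : JudgeWins₁ κ lam N γ) : JudgeWins₂ κ lam N γ := by
  obtain ⟨σ, hσ⟩ := h
  obtain ⟨τ, hτ⟩ := exists_strategy (lam := lam) (N := N) (γ := γ) PlayState.set
    (fun x s j => x j + 1 < (s j).move ∧ (∀ k < j, (s k).bound ≤ (s j).move) ∧
      ChallengerLegal lam N (fun k => (s k).move) (fun k => (s k).ultra) j (s j).move ∧
      (s j).ultra = answer σ (fun k => (s k).move) (fun k => (s k).ultra) j (s j).move ∧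
      (s j).bound < (Order.succ lam).ord ∧ (s j).set ⊆ Pk κ lam ∧
      (∀ X ∈ (s j).ultra, X ∈ N (x j + 1) → SubsetMod κ lam (s j).set X) ∧
      ¬ SubsetMod κ lam (s j).set ∅ ∧
      (j + 1 < γ → InUnion lam N (s j).set ∧ ∀ U b, (s j).bound ≤ b → b < (Order.succ lam).ord →
        (s j).ultra ⊆ U → IsNormalUltrafilter κ lam (N (b + 1)) U → (s j).set ∈ U))
    (fun x x' s s' j hx hs ⟨h1, h2, h3, h4, h5⟩ => by
      rw [← hs j le_rfl, ← hx j le_rfl]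
      have e1 : ∀ k < j, (s k).move = (s' k).move := fun k hk => by rw [hs k hk.le]
      have e2 : ∀ k < j, (s k).ultra = (s' k).ultra := fun k hk => by rw [hs k hk.le]
      exact ⟨h1, fun k hk => hs k hk.le ▸ h2 k hk, h3.congr e1 e2, answer_congr e1 e2 ▸ h4, h5⟩)
    (fun x s j hj hx ih => by
      have hrun : IsRun lam N σ (fun k => (s k).move) (fun k => (s k).ultra) j :=
        isRun_iff.2 fun k hk => ⟨(ih k hk).2.2.1, (ih k hk).2.2.2.1⟩
      obtain ⟨b, hb⟩ := (hσ _ _ j hj.le hrun).2 hj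
      obtain ⟨c, hc, hbc⟩ := hp.exists_bound (hj.trans_le hγ) fun k hk => (ih k hk).2.2.2.2.1
      -- Three demands on the simulated move: legality through `b`, membership of the earlier sets
      -- in the new ultrafilter through `c`, and `N (x j + 1)` being an element of the larger model
      -- through `x j + 1 + 1`.
      let a := max (max b c) (x j + 1 + 1)
      have hxa : x j + 1 < a := (lt_add_one _).trans_le (le_max_right _ _)
      have ha : ChallengerLegal lam N (fun k => (s k).move) (fun k => (s k).ultra) j a :=
        hb.mono hN hp ((le_max_left _ _).trans (le_max_left _ _))
          (max_lt (max_lt hb.1 hc) (hp.succ_lt (hp.succ_lt (hx j le_rfl).1)))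
      let U := answer σ (fun k => (s k).move) (fun k => (s k).ultra) j a
      obtain ⟨Y, w, hw, hYP, hY⟩ := exists_generator hN hp hγ hcase hσ hj (hrun.extend ha)
        (c := x j + 1) (by simpa [Function.update_self] using hxa)
      rw [Function.update_self] at hY
      refine ⟨⟨a, U, Y, w⟩, ?_⟩
      simp only [Function.update_self]
      refine ⟨hxa, fun k hk => ?_, ha.congr ?_ ?_, answer_congr ?_ ?_, hw, hYP, hY⟩
      · rw [update_of_lt _ _ hk]
        exact (hbc k hk).le.trans ((le_max_right _ _).trans (le_max_left _ _))
      all_goals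
        intro k hk
        rw [update_of_lt _ _ hk])
  refine ⟨τ, fun α m ℓ hℓ hrun => ?_⟩
  obtain ⟨s, hm, hs⟩ := hτ α m ℓ hℓ hrun
  have hrun' : IsRun lam N σ (fun k => (s k).move) (fun k => (s k).ultra) ℓ :=
    isRun_iff.2 fun k hk => ⟨(hs k hk).2.2.1, (hs k hk).2.2.2.1⟩
  have hJ := (hσ _ _ ℓ hℓ hrun').1
  refine ⟨fun i hi => ?_, fun hlt => ?_⟩
  · have hi1 := hp.succ_lt (hrun i hi).1.1
    have hM := hN.model _ hi1
    obtain ⟨h1, h2, h3, -, -, hYP, hY, hY', -⟩ := hs i hi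
    have hsub : N (α i + 1) ⊆ N ((s i).move + 1) :=
      hN.mono (h1.le.trans le_self_add) (hp.succ_lt h3.1)
    rw [JudgeLegal₂, hm i hi, generated_eq_inter (hJ i hi).1 hp hM hsub hY hY']
    refine ⟨hYP, fun j hj => ?_, (hJ i hi).1.inter hp hM hsub⟩
    have hjℓ := hj.trans hi
    have hjγ : j + 1 < γ := (Order.add_one_le_iff.2 hj).trans_lt (hi.trans_le hℓ)
    -- The earlier set lies in the simulated ultrafilter, since the move exceeds its bound, and in
    -- `N (α i + 1)`, by legality of the Challenger's actual move. Hence the new set is contained in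
    -- it modulo the fine filter.
    refine hY _ ?_ ((hrun i hi).1.inUnion hN hp ((hi.trans_le hℓ).trans_le hγ) hj)
    rw [hm j hjℓ]
    obtain ⟨-, hU⟩ := (hs j hjℓ).2.2.2.2.2.2.2.2 hjγ
    exact hU _ _ (h2 j hj) h3.1 ((hJ i hi).2 j hj) (hJ i hi).1
  · refine exists_challengerLegal hN hp (hlt.trans_le hγ) (fun j hj => (hrun j hj).1.1)
      (hσ.seq_inUnion hN hp hγ (boundedFibers₁ hN hp) hlarge hlt fun j hj => ?_)
    rw [hm j hj]
    exact ((hs j hj).2.2.2.2.2.2.2.2 ((Order.add_one_le_iff.2 hj).trans_lt hlt)).1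

end

end FilterGame

end

theorem mainTheorem12 (κ lam θ : Cardinal.{u}) (hκ : ℵ₀ ≤ κ) (hκlam : κ ≤ lam)
    (hpow : lam ^< κ = lam) (hθ : θ.IsRegular) (hlamθ : lam < θ)
    (N : Ordinal.{u} → ZFSet.{u})
    (hN : FilterGame.IsInternallyApproachable κ lam θ N)
    (hlarge : Order.succ lam < θ ∨
      ∀ x ∈ FilterGame.H θ, ∃ i < (Order.succ lam).ord, x ∈ N i)
    (γ : Ordinal.{u}) (hγ : γ ≤ (Order.succ lam).ord) :
    (FilterGame.JudgeWins₂ κ lam N γ → FilterGame.JudgeWins₁ κ lam N γ) ∧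
    ((Order.IsSuccPrelimit γ ∨ (2 : Cardinal.{u}) ^< lam = lam) →
      (FilterGame.JudgeWins₁ κ lam N γ → FilterGame.JudgeWins₂ κ lam N γ)) := by
  have hp : FilterGame.Admissible κ lam θ := ⟨hκ, hκlam, hpow, hlamθ⟩
  exact ⟨FilterGame.judgeWins₁_of_judgeWins₂ hN hp hlarge hγ,
    fun hcase => FilterGame.judgeWins₂_of_judgeWins₁ hN hp hlarge hγ hcase⟩
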